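/- Let $d\in\mathbb N$, let $\Omega=(0,1)^d$ carry Lebesgue measure, and let $\mathbb H=L^2(\Omega;\mathbb R^d)$. Let $\mathcal P_2(\mathbb R^d)$ be the set of Borel probability measures on $\mathbb R^d$ with finite second moment, with the Wasserstein distance $W_2$, and let $\Gamma_o(\mu,\nu)$ be the set of optimal plans for the quadratic cost between $\mu$ and $\nu$. For $x\in\mathbb H$ let $\sharp(x)\in\mathcal P_2(\mathbb R^d)$ be its law. Let $\mathcal U:\mathcal P_2(\mathbb R^d)\to\mathbb R$ and let $\tilde{\mathcal U}:=\mathcal U\circ\sharp:\mathbb H\to\mathbb R$ be its lift. We say that $\mathcal U$ is differentiable at $\mu$ with Wasserstein gradient $\nabla_w\mathcal U(\mu)=\xi$ if $\xi$ belongs to the closure of $\{\nabla\varphi:\varphi\in C_c^\infty(\mathbb R^d)\}$ in $L^2(\mu;\mathbb R^d)$ and $$\mathcal U(\nu)-\mathcal U(\mu)-\int_{\mathbb R^d\times\mathbb R^d}\xi(q_1)\cdot(q_2-q_1)\,d\gamma(q_1,q_2)=o\big(W_2(\mu,\nu)\big)\qquad(W_2(\mu,\nu)\to0),$$ uniformly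 in $\gamma\in\Gamma_o(\mu,\nu)$. We say that $\mathcal U$ is continuously differentiable if it is differentiable at every $\mu$ and, for every $\mu$, $\int|\nabla_w\mathcal U(\nu)(q_2)-\nabla_w\mathcal U(\mu)(q_1)|^2\,d\gamma(q_1,q_2)\to0$ as $W_2(\mu,\nu)\to0$, uniformly in $\gamma\in\Gamma_o(\mu,\nu)$. We write $\mathcal U\in C^{1,1}(\mathcal P_2(\mathbb R^d))$ if $\mathcal U$ is continuously differentiable and there is $C\ge0$ such that 1. for every $\mu$, $\nabla_w\mathcal U(\mu)$ has a representative that is $C$-Lipschitz on $\operatorname{spt}\mu$; 2. $\left|\mathcal U(\nu)-\mathcal U(\mu)-\int\nabla_w\mathcal U(\mu)(q_1)\cdot(q_2-q_1)\,d\gamma(q_1,q_2)\right|\le C\,W_2^2(\mu,\nu)$ for all $\mu,\nu\in\mathcal P_2(\mathbb R^d)$ and all $\gamma\in\Gamma_o(\mu,\nu)$. We write $\tilde{\mathcal U}\in C^{1,1}(\mathbb H)$ if $\tilde{\mathcal U}$ is Fréchet differentiable on $\mathbb H$ and $\|\nabla\tilde{\mathcal U}(x)-\nabla\tilde{\mathcal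 U}(y)\|\le C\|x-y\|$ for some $C>0$ and all $x,y\in\mathbb H$. Then $\mathcal U\in C^{1,1}(\mathcal P_2(\mathbb R^d))$ if and only if $\tilde{\mathcal U}\in C^{1,1}(\mathbb H)$. Moreover, if $\tilde{\mathcal U}$ is Fréchet differentiable and $\nabla\tilde{\mathcal U}$ is $C$-Lipschitz on $\mathbb H$, then $\mathcal U$ is differentiable at every $\mu\in\mathcal P_2(\mathbb R^d)$ and $\nabla_w\mathcal U(\mu)$ has a representative that is $C$-Lipschitz on $\operatorname{spt}\mu$, with the same $C$ for all $\mu$. -/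

import Mathlib

open MeasureTheory
open scoped ENNReal

noncomputable section

/-- The Euclidean space `ℝ^d`. -/
abbrev Eucl (d : ℕ) : Type := EuclideanSpace ℝ (Fin d)

/-- The open unit cube `Ω = (0,1)^d`. -/
def unitCube (d : ℕ) : Set (Eucl d) := {ω | ∀ i, ω i ∈ Set.Ioo (0 : ℝ) 1}

/-- Lebesgue measure restricted to the unit cube. -/
def cubeMeasure (d : ℕ) : Measure (Eucl d) := volume.restrict (unitCube d)

instance cubeMeasure.instIsProbabilityMeasure (d : ℕ) :
    IsProbabilityMeasure (cubeMeasure d) := by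
  constructor
  have h : unitCube d =
      (WithLp.ofLp : Eucl d → Fin d → ℝ) ⁻¹' (Set.univ.pi fun _ => Set.Ioo (0 : ℝ) 1) := by
    ext ω
    simp [unitCube]
  rw [cubeMeasure, Measure.restrict_apply_univ, h,
    (PiLp.volume_preserving_ofLp (Fin d)).measure_preimage
      (MeasurableSet.univ_pi fun _ => measurableSet_Ioo).nullMeasurableSet,
    volume_pi_pi]
  simp

/-- The Hilbert space `ℍ = L²((0,1)^d; ℝ^d)`. -/
abbrev HilbertH (d : ℕ) : Type := Lp (Eucl d) 2 (cubeMeasure d)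

/-- `𝒫₂(ℝ^d)`: the Borel probability measures on `ℝ^d` with finite second moment. -/
@[ext]
structure P2 (d : ℕ) where
  /-- the underlying measure -/
  toMeasure : Measure (Eucl d)
  isProbabilityMeasure : IsProbabilityMeasure toMeasure
  secondMoment_lt_top : ∫⁻ q, ‖q‖ₑ ^ 2 ∂toMeasure < ⊤

/-- The law `♯(x) = x_♯ 𝓛^d_Ω` of `x ∈ ℍ`. -/
def law {d : ℕ} (x : HilbertH d) : P2 d where
  toMeasure := (cubeMeasure d).map x
  isProbabilityMeasure := Measure.isProbabilityMeasure_map (Lp.aestronglyMeasurable x).aemeasurable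
  secondMoment_lt_top := by
    rw [lintegral_map' (by fun_prop) (Lp.aestronglyMeasurable x).aemeasurable]
    have h := (Lp.memLp x).eLpNorm_lt_top
    rw [eLpNorm_lt_top_iff_lintegral_rpow_enorm_lt_top (by norm_num) (by norm_num)] at h
    simpa using h

/-- The lift `Ũ = U ∘ ♯` of `U` to `ℍ`. -/
def hilbertLift {d : ℕ} (U : P2 d → ℝ) : HilbertH d → ℝ := fun x => U (law x)

/-- `f ∈ C^{1,1}(ℍ)`, with Lipschitz constant `C` of the Fréchet gradient. -/
def IsC11WithH {d : ℕ} (C : ℝ) (f : HilbertH d → ℝ) : Prop :=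
  Differentiable ℝ f ∧ ∀ x y : HilbertH d, ‖gradient f x - gradient f y‖ ≤ C * ‖x - y‖

/-- `f ∈ C^{1,1}(ℍ)`: `f` is Fréchet differentiable and its differential is Lipschitz. -/
def IsC11H {d : ℕ} (f : HilbertH d → ℝ) : Prop :=
  ∃ C : ℝ, 0 < C ∧ IsC11WithH C f

/-- `Γ(μ, ν)`: the measures on `ℝ^d × ℝ^d` with marginals `μ` and `ν`
(they are automatically probability measures). -/
def couplings {d : ℕ} (μ ν : P2 d) : Set (Measure (Eucl d × Eucl d)) :=
  {γ | γ.map Prod.fst = μ.toMeasure ∧ γ.map Prod.snd = ν.toMeasure}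

/-- The quadratic transport cost `∫ |q₁ - q₂|² dγ`. -/
def transportCost {d : ℕ} (γ : Measure (Eucl d × Eucl d)) : ℝ≥0∞ :=
  ∫⁻ p, ‖p.1 - p.2‖ₑ ^ 2 ∂γ

/-- The Wasserstein distance `W₂`. -/
def W2 {d : ℕ} (μ ν : P2 d) : ℝ :=
  √(⨅ γ ∈ couplings μ ν, transportCost γ).toReal

/-- `Γ_o(μ, ν)`: the optimal plans between `μ` and `ν`. -/
def optimalPlans {d : ℕ} (μ ν : P2 d) : Set (Measure (Eucl d × Eucl d)) :=
  {γ | γ ∈ couplings μ ν ∧ transportCost γ = ENNReal.ofReal (W2 μ ν ^ 2)}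

/-- The tangent space `T_μ 𝒫₂(ℝ^d)`: the closure of `∇ C_c^∞(ℝ^d)` in `L²(μ)`. -/
def tangentSpace {d : ℕ} (μ : P2 d) : Set (Lp (Eucl d) 2 μ.toMeasure) :=
  closure {v | ∃ φ : Eucl d → ℝ, ContDiff ℝ (⊤ : ℕ∞) φ ∧ HasCompactSupport φ ∧
    v =ᵐ[μ.toMeasure] gradient φ}

/-- `U` is differentiable at `μ` and `ξ` is a representative of `∇_w U(μ)`: the class of `ξ` lies in
`T_μ 𝒫₂(ℝ^d)` and
`U(ν) - U(μ) = ∫ ξ(q₁) · (q₂ - q₁) dγ + o(W₂(μ, ν))`, uniformly in `γ ∈ Γ_o(μ, ν)`. -/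
def HasWassersteinGradientAt {d : ℕ} (U : P2 d → ℝ) (μ : P2 d) (ξ : Eucl d → Eucl d) : Prop :=
  (∃ h : MemLp ξ 2 μ.toMeasure, h.toLp ξ ∈ tangentSpace μ) ∧
  ∀ ε : ℝ, 0 < ε → ∃ δ : ℝ, 0 < δ ∧ ∀ ν : P2 d, W2 μ ν < δ → ∀ γ ∈ optimalPlans μ ν,
    |U ν - U μ - ∫ p, inner ℝ (ξ p.1) (p.2 - p.1) ∂γ| ≤ ε * W2 μ ν

/-- `U` is continuously differentiable on `𝒫₂(ℝ^d)` and `G μ` represents `∇_w U(μ)` for every `μ`.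
Continuity of the gradient field, whose values lie in different spaces `L²(μ)`, is tested along
optimal plans: `∫ |∇_w U(ν)(q₂) - ∇_w U(μ)(q₁)|² dγ → 0` as `W₂(μ, ν) → 0`, `γ ∈ Γ_o(μ, ν)`. -/
def IsC1WassersteinWith {d : ℕ} (U : P2 d → ℝ) (G : P2 d → Eucl d → Eucl d) : Prop :=
  (∀ μ, HasWassersteinGradientAt U μ (G μ)) ∧
  ∀ μ, ∀ ε : ℝ, 0 < ε → ∃ δ : ℝ, 0 < δ ∧ ∀ ν : P2 d, W2 μ ν < δ → ∀ γ ∈ optimalPlans μ ν,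
    ∫⁻ p, ‖G ν p.2 - G μ p.1‖ₑ ^ 2 ∂γ ≤ ENNReal.ofReal ε

/-- `ξ` is Lipschitz with constant `C` on the support of `μ`. -/
def LipschitzOnSupport {d : ℕ} (C : ℝ) (μ : P2 d) (ξ : Eucl d → Eucl d) : Prop :=
  ∀ q ∈ μ.toMeasure.support, ∀ q' ∈ μ.toMeasure.support, ‖ξ q - ξ q'‖ ≤ C * ‖q - q'‖

/-- `U ∈ C^{1,1}(𝒫₂(ℝ^d))`; `G μ` is the representative of `∇_w U(μ)` that is Lipschitz on
`spt μ`. -/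
def IsC11Wasserstein {d : ℕ} (U : P2 d → ℝ) : Prop :=
  ∃ G : P2 d → Eucl d → Eucl d, IsC1WassersteinWith U G ∧ ∃ C : ℝ, 0 ≤ C ∧
    (∀ μ, LipschitzOnSupport C μ (G μ)) ∧
    ∀ μ ν : P2 d, ∀ γ ∈ optimalPlans μ ν,
      |U ν - U μ - ∫ p, inner ℝ (G μ p.1) (p.2 - p.1) ∂γ| ≤ C * W2 μ ν ^ 2

end

/-! From `U` to its lift. The hypothesis is a Taylor bound along optimal plans, whereas the joint
law of two elements of `ℍ` is usually not optimal. If `x` takes finitely many values, however, any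
sufficiently small uniform perturbation of `x` is optimally coupled to it, because each value
remains the nearest one. Along the segment between two finitely valued maps the Taylor bound
therefore holds locally, from every base point and in both directions. Adding the two directions
shows that the derivative along the segment is Lipschitz, and integrating gives a global bound
(`taylor_of_finitelyValued`). Nearest-point approximation is optimal for its target, so values and
gradients pass to the limit and the bound holds on all of `ℍ` (`taylor_of_isC1`). A Taylor bound at
all pairs of points identifies the gradient and makes it Lipschitz.

From the lift to `U`. The lift is invariant under measure-preserving rearrangements of the cube, so
its gradient commutes with them. Suppose the joint law of `x` and its gradient violated the bound
`C` between two points of its support. Some translation makes the corresponding sets of positive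
measure overlap; exchanging the two overlapping pieces would then move the gradient by more than `C`
times the displacement of `x`. Hence the gradient is `ξ ∘ x`, with `ξ` Lipschitz with the same `C`
on the support (`IsC11WithH.exists_field`). Differentiating in the direction `(ξ - η) ∘ x` shows
that `ξ` depends only on the law.

Tangency of `ξ` is obtained by collapsing `x` to a constant `q` on a set `A` of small mass. The lift
divided by the mass of `A` becomes a function of `q` in `ℝ^d` whose gradient is Lipschitz uniformly
in `A`, hence tangent by cutoff and mollification. These gradients converge to `ξ` on the support as
the mass vanishes (`IsC11WithH.tendsto_collapseGradient`). Finally every optimal plan is a joint law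
on the cube, so Taylor and Lipschitz bounds on `ℍ` descend to `𝒫₂`. -/

noncomputable section

/-! ### Joint laws, transport cost and optimality by nearest points -/

section Basics

variable {d : ℕ}

instance P2.instIsProbabilityMeasure (μ : P2 d) : IsProbabilityMeasure μ.toMeasure :=
  μ.isProbabilityMeasure

/-- The squared norm of `L²` as a Lebesgue integral. -/
theorem ofReal_norm_sq_Lp {α E : Type*} [MeasurableSpace α] [NormedAddCommGroup E] {μ : Measure α}
    (x : Lp E 2 μ) : ENNReal.ofReal (‖x‖ ^ 2) = ∫⁻ ω, ‖x ω‖ₑ ^ 2 ∂μ := by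
  rw [Lp.norm_def, ← ENNReal.toReal_pow, ENNReal.ofReal_toReal (by finiteness),
    eLpNorm_eq_lintegral_rpow_enorm_toReal (by norm_num) (by norm_num), ← ENNReal.rpow_natCast,
    ← ENNReal.rpow_mul]
  simp

theorem ofReal_norm_sub_sq_Lp {α E : Type*} [MeasurableSpace α] [NormedAddCommGroup E]
    {μ : Measure α} (x y : Lp E 2 μ) :
    ENNReal.ofReal (‖x - y‖ ^ 2) = ∫⁻ ω, ‖x ω - y ω‖ₑ ^ 2 ∂μ := by
  rw [ofReal_norm_sq_Lp]
  refine lintegral_congr_ae ?_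
  filter_upwards [Lp.coeFn_sub x y] with ω h
  rw [h, Pi.sub_apply]

theorem measurable_coeFn_Lp (x : HilbertH d) : Measurable x := (Lp.stronglyMeasurable x).measurable

/-- The joint law of `x` and `y`. -/
def pairLaw (x y : HilbertH d) : Measure (Eucl d × Eucl d) :=
  (cubeMeasure d).map fun ω => (x ω, y ω)

theorem measurable_pair (x y : HilbertH d) : Measurable fun ω => (x ω, y ω) :=
  (measurable_coeFn_Lp x).prodMk (measurable_coeFn_Lp y)

theorem map_fst_pairLaw (x y : HilbertH d) : (pairLaw x y).map Prod.fst = (law x).toMeasure := by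
  rw [pairLaw, Measure.map_map measurable_fst (measurable_pair x y)]
  rfl

theorem map_snd_pairLaw (x y : HilbertH d) : (pairLaw x y).map Prod.snd = (law y).toMeasure := by
  rw [pairLaw, Measure.map_map measurable_snd (measurable_pair x y)]
  rfl

theorem pairLaw_mem_couplings (x y : HilbertH d) : pairLaw x y ∈ couplings (law x) (law y) :=
  ⟨map_fst_pairLaw x y, map_snd_pairLaw x y⟩

theorem transportCost_pairLaw (x y : HilbertH d) :
    transportCost (pairLaw x y) = ENNReal.ofReal (‖x - y‖ ^ 2) := by
  rw [transportCost, pairLaw, lintegral_map (by fun_prop) (measurable_pair x y),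
    ofReal_norm_sub_sq_Lp]

theorem W2_nonneg (μ ν : P2 d) : 0 ≤ W2 μ ν := Real.sqrt_nonneg _

/-- A coupling of least cost is optimal. -/
theorem pairLaw_optimal_of_le {x y : HilbertH d}
    (h : ∀ γ ∈ couplings (law x) (law y), transportCost (pairLaw x y) ≤ transportCost γ) :
    pairLaw x y ∈ optimalPlans (law x) (law y) ∧ W2 (law x) (law y) = ‖x - y‖ := by
  have hinf : (⨅ γ ∈ couplings (law x) (law y), transportCost γ) = transportCost (pairLaw x y) :=
    le_antisymm (iInf₂_le _ (pairLaw_mem_couplings x y)) (le_iInf₂ h)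
  have hW : W2 (law x) (law y) = ‖x - y‖ := by
    rw [W2, hinf, transportCost_pairLaw, ENNReal.toReal_ofReal (sq_nonneg _),
      Real.sqrt_sq (norm_nonneg _)]
  exact ⟨⟨pairLaw_mem_couplings x y, by rw [hW, transportCost_pairLaw]⟩, hW⟩

/-- If `x` takes values in `S` and `x ω` is a point of `S` closest to `y ω`, then the joint laws of
`x` and `y` are optimal plans. -/
theorem pairLaw_optimal_of_infEDist {S : Set (Eucl d)} (hS : IsClosed S) {x y : HilbertH d}
    (hx : ∀ᵐ ω ∂cubeMeasure d, x ω ∈ S)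
    (hxy : ∀ᵐ ω ∂cubeMeasure d, ∀ s ∈ S, ‖x ω - y ω‖ ≤ ‖s - y ω‖) :
    (pairLaw x y ∈ optimalPlans (law x) (law y) ∧ W2 (law x) (law y) = ‖x - y‖) ∧
    (pairLaw y x ∈ optimalPlans (law y) (law x) ∧ W2 (law y) (law x) = ‖x - y‖) := by
  have hm : Measurable fun q : Eucl d => Metric.infEDist q S ^ 2 :=
    (measurable_infEDist).pow_const 2
  have hxS : ∀ᵐ q ∂(law x).toMeasure, q ∈ S :=
    (ae_map_iff (measurable_coeFn_Lp x).aemeasurable hS.measurableSet).2 hx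
  -- The integral of the squared distance to `S` against the law of `y` is a lower bound for the
  -- cost of every coupling, and nearest points attain it.
  have hcost : transportCost (pairLaw x y) ≤
      ∫⁻ q, Metric.infEDist q S ^ 2 ∂(law y).toMeasure := by
    rw [transportCost_pairLaw, ofReal_norm_sub_sq_Lp]
    change _ ≤ ∫⁻ q, Metric.infEDist q S ^ 2 ∂((cubeMeasure d).map y)
    rw [lintegral_map hm (measurable_coeFn_Lp y)]
    refine lintegral_mono_ae ?_
    filter_upwards [hxy] with ω hω
    gcongr
    refine Metric.le_infEDist.2 fun s hs => ?_
    rw [edist_comm, edist_eq_enorm_sub]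
    exact enorm_le_iff_norm_le.2 (hω s hs)
  have hcost' : transportCost (pairLaw y x) = transportCost (pairLaw x y) := by
    rw [transportCost_pairLaw, transportCost_pairLaw, norm_sub_rev]
  refine ⟨pairLaw_optimal_of_le fun γ hγ => hcost.trans ?_, ?_⟩
  · rw [← hγ.2, lintegral_map hm measurable_snd]
    refine lintegral_mono_ae ?_
    rw [← hγ.1] at hxS
    filter_upwards [ae_of_ae_map measurable_fst.aemeasurable hxS] with p hp
    gcongr
    rw [← edist_eq_enorm_sub, edist_comm]
    exact Metric.infEDist_le_edist_of_mem hp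
  · rw [norm_sub_rev]
    refine pairLaw_optimal_of_le fun γ hγ => hcost'.le.trans (hcost.trans ?_)
    rw [← hγ.1, lintegral_map hm measurable_fst]
    refine lintegral_mono_ae ?_
    rw [← hγ.2] at hxS
    filter_upwards [ae_of_ae_map measurable_snd.aemeasurable hxS] with p hp
    gcongr
    rw [← edist_eq_enorm_sub]
    exact Metric.infEDist_le_edist_of_mem hp

/-- Composition of a square-integrable field on `ℝ^d` with an element of `ℍ`. -/
def fieldComp (x : HilbertH d) (ξ : Eucl d → Eucl d) (h : MemLp ξ 2 (law x).toMeasure) :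
    HilbertH d :=
  (h.comp_of_map (measurable_coeFn_Lp x).aemeasurable).toLp (ξ ∘ x)

theorem coeFn_fieldComp (x : HilbertH d) (ξ : Eucl d → Eucl d)
    (h : MemLp ξ 2 (law x).toMeasure) :
    fieldComp x ξ h =ᵐ[cubeMeasure d] fun ω => ξ (x ω) :=
  MemLp.coeFn_toLp _

theorem integral_pairLaw {x y : HilbertH d} {ξ : Eucl d → Eucl d}
    (h : MemLp ξ 2 (law x).toMeasure) {u : HilbertH d}
    (hu : u =ᵐ[cubeMeasure d] fun ω => ξ (x ω)) :
    ∫ p, inner ℝ (ξ p.1) (p.2 - p.1) ∂(pairLaw x y) = inner ℝ u (y - x) := by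
  have hξ : AEStronglyMeasurable (fun p : Eucl d × Eucl d => ξ p.1) (pairLaw x y) := by
    refine AEStronglyMeasurable.comp_measurable (g := ξ) (f := Prod.fst) ?_ measurable_fst
    rw [map_fst_pairLaw]
    exact h.1
  have hm : AEStronglyMeasurable (fun p : Eucl d × Eucl d => inner ℝ (ξ p.1) (p.2 - p.1))
      (pairLaw x y) := hξ.inner (by fun_prop)
  rw [pairLaw] at hm ⊢
  rw [integral_map (measurable_pair x y).aemeasurable hm, L2.inner_def]
  refine integral_congr_ae ?_
  filter_upwards [hu, Lp.coeFn_sub y x] with ω h1 h2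
  rw [h1, h2, Pi.sub_apply]

theorem lintegral_pairLaw_sub {x y : HilbertH d} {ξ η : Eucl d → Eucl d}
    (hξ : MemLp ξ 2 (law x).toMeasure) (hη : MemLp η 2 (law y).toMeasure) {u v : HilbertH d}
    (hu : u =ᵐ[cubeMeasure d] fun ω => ξ (x ω)) (hv : v =ᵐ[cubeMeasure d] fun ω => η (y ω)) :
    ∫⁻ p, ‖η p.2 - ξ p.1‖ₑ ^ 2 ∂(pairLaw x y) = ENNReal.ofReal (‖v - u‖ ^ 2) := by
  have h1 : AEStronglyMeasurable (fun p : Eucl d × Eucl d => ξ p.1) (pairLaw x y) := by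
    refine AEStronglyMeasurable.comp_measurable (g := ξ) (f := Prod.fst) ?_ measurable_fst
    rw [map_fst_pairLaw]
    exact hξ.1
  have h2 : AEStronglyMeasurable (fun p : Eucl d × Eucl d => η p.2) (pairLaw x y) := by
    refine AEStronglyMeasurable.comp_measurable (g := η) (f := Prod.snd) ?_ measurable_snd
    rw [map_snd_pairLaw]
    exact hη.1
  have hm : AEMeasurable (fun p : Eucl d × Eucl d => ‖η p.2 - ξ p.1‖ₑ ^ 2) (pairLaw x y) :=
    ((h2.sub h1).enorm).pow_const 2
  rw [pairLaw] at hm ⊢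
  rw [lintegral_map' hm (measurable_pair x y).aemeasurable, ofReal_norm_sub_sq_Lp]
  refine lintegral_congr_ae ?_
  filter_upwards [hu, hv] with ω h1 h2
  simp [h1, h2]

end Basics

/-! ### Second-order Taylor estimates on the line and in Hilbert space -/

section SecondOrder

open Filter Topology

/-- A pointwise bound on difference quotients of `g` gives a bound on increments of `g`. -/
theorem sub_le_of_eventually_abs_sub_le {g : ℝ → ℝ} {K : ℝ}
    (h : ∀ t₀, ∀ᶠ t in 𝓝 t₀, |g t - g t₀| ≤ K * |t - t₀|) {t : ℝ} (ht : 0 ≤ t) :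
    g t - g 0 ≤ K * t := by
  have hcont : Continuous g := by
    refine continuous_iff_continuousAt.2 fun t₀ => ?_
    rw [ContinuousAt, tendsto_iff_dist_tendsto_zero]
    refine squeeze_zero' (Eventually.of_forall fun _ => dist_nonneg) (h t₀) ?_
    have : Tendsto (fun t => K * |t - t₀|) (𝓝 t₀) (𝓝 (K * |t₀ - t₀|)) := by
      apply Continuous.tendsto
      fun_prop
    simpa using this
  have := image_le_of_liminf_slope_right_le_deriv_boundary (f := g) (a := 0) (b := t)
    (B := fun s => g 0 + K * s) (B' := fun _ => K) hcont.continuousOn (by simp) (by fun_prop)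
    (fun s _ => by simpa using (((hasDerivAt_id s).const_mul K).const_add (g 0)).hasDerivWithinAt)
    (fun s _ r hr => by
      refine Eventually.frequently ?_
      filter_upwards [nhdsWithin_le_nhds (h s), self_mem_nhdsWithin] with z hz hzs
      have hzs' : 0 < z - s := sub_pos.2 hzs
      rw [slope_def_field, div_lt_iff₀ hzs']
      rw [abs_of_pos hzs'] at hz
      nlinarith [le_abs_self (g z - g s)]) (x := t) ⟨ht, le_rfl⟩
  linarith

/-- A local second-order Taylor estimate on the line, at every point and in both directions, implies
a global one. -/
theorem abs_sub_sub_le_of_local_taylor {f g : ℝ → ℝ} {K : ℝ}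
    (h₁ : ∀ t₀, ∀ᶠ t in 𝓝 t₀, |f t - f t₀ - g t₀ * (t - t₀)| ≤ K * (t - t₀) ^ 2)
    (h₂ : ∀ t₀, ∀ᶠ t in 𝓝 t₀, |f t₀ - f t - g t * (t₀ - t)| ≤ K * (t - t₀) ^ 2) :
    |f 1 - f 0 - g 0| ≤ 2 * K := by
  have hK : 0 ≤ K := by
    obtain ⟨ε, hε, hb⟩ := Metric.eventually_nhds_iff.1 (h₁ 0)
    have h := (abs_nonneg _).trans (hb (y := ε / 2) (by simp [abs_of_pos hε]; linarith))
    have : 0 < (ε / 2 - 0) ^ 2 := by rw [sub_zero]; positivity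
    exact nonneg_of_mul_nonneg_left h this
  have hd : ∀ t, HasDerivAt f (g t) t := by
    intro t₀
    rw [hasDerivAt_iff_isLittleO]
    have hO : (fun t => f t - f t₀ - (t - t₀) • g t₀) =O[𝓝 t₀] fun t => (t - t₀) ^ 2 := by
      refine Asymptotics.IsBigO.of_bound K ?_
      filter_upwards [h₁ t₀] with t ht
      simpa [mul_comm] using ht
    refine hO.trans_isLittleO ?_
    have h1 : Tendsto (fun t : ℝ => t - t₀) (𝓝 t₀) (𝓝 0) := by
      have : Tendsto (fun t : ℝ => t - t₀) (𝓝 t₀) (𝓝 (t₀ - t₀)) := by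
        apply Continuous.tendsto
        fun_prop
      simpa using this
    exact (Asymptotics.isLittleO_pow_id (𝕜 := ℝ) (n := 2) (by norm_num)).comp_tendsto h1
  -- Adding the estimates based at `t₀` and at `t` cancels the values of `f` and leaves `(g t - g
  -- t₀) * (t - t₀)`.
  have hg : ∀ t₀, ∀ᶠ t in 𝓝 t₀, |g t - g t₀| ≤ 2 * K * |t - t₀| := by
    intro t₀
    filter_upwards [h₁ t₀, h₂ t₀] with t a b
    rcases eq_or_ne t t₀ with rfl | hne
    · simp
    have hpos : 0 < |t - t₀| := abs_pos.2 (sub_ne_zero.2 hne)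
    have hsum : |g t - g t₀| * |t - t₀| ≤ 2 * K * |t - t₀| * |t - t₀| := by
      rw [← abs_mul, mul_assoc, abs_mul_abs_self]
      calc |(g t - g t₀) * (t - t₀)|
          = |(f t - f t₀ - g t₀ * (t - t₀)) + (f t₀ - f t - g t * (t₀ - t))| := by
            congr 1; ring
        _ ≤ K * (t - t₀) ^ 2 + K * (t - t₀) ^ 2 := (abs_add_le _ _).trans (add_le_add a b)
        _ = 2 * K * ((t - t₀) * (t - t₀)) := by ring
    exact le_of_mul_le_mul_right hsum hpos
  have hbound : ∀ t ∈ Set.Ico (0 : ℝ) 1, ‖g t - g 0‖ ≤ 2 * K := by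
    intro t ht
    have a := sub_le_of_eventually_abs_sub_le hg ht.1
    have b := sub_le_of_eventually_abs_sub_le (g := fun t => - g t) (K := 2 * K)
      (fun t₀ => by
        filter_upwards [hg t₀] with t ht
        rwa [neg_sub_neg, abs_sub_comm]) ht.1
    have h3 : 2 * K * t ≤ 2 * K := by nlinarith [ht.2]
    rw [Real.norm_eq_abs, abs_le]
    constructor <;> linarith
  have := norm_image_sub_le_of_norm_deriv_le_segment_01' (f := fun t => f t - g 0 * t)
    (f' := fun t => g t - g 0)
    (fun t _ => ((hd t).sub (by simpa using (hasDerivAt_id t).const_mul (g 0))).hasDerivWithinAt)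
    hbound
  rw [Real.norm_eq_abs] at this
  convert this using 2
  ring

variable {F : Type*} [NormedAddCommGroup F] [InnerProductSpace ℝ F]

/-- A uniform second-order Taylor estimate identifies the gradient. -/
theorem hasGradientAt_of_taylor [CompleteSpace F] {f : F → ℝ} {g : F → F} {K : ℝ}
    (h : ∀ x y, |f y - f x - inner ℝ (g x) (y - x)| ≤ K * ‖y - x‖ ^ 2) (x : F) :
    HasGradientAt f (g x) x := by
  rw [hasGradientAt_iff_isLittleO]
  have hO : (fun y => f y - f x - inner ℝ (g x) (y - x)) =O[𝓝 x] fun y => ‖y - x‖ ^ 2 :=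
    Asymptotics.IsBigO.of_bound K (Eventually.of_forall fun y => by simpa using h x y)
  refine hO.trans_isLittleO ?_
  have h1 : Tendsto (fun y : F => ‖y - x‖) (𝓝 x) (𝓝 0) := by
    have : Tendsto (fun y : F => ‖y - x‖) (𝓝 x) (𝓝 ‖x - x‖) := by
      apply Continuous.tendsto
      fun_prop
    simpa using this
  have := (Asymptotics.isLittleO_pow_id (𝕜 := ℝ) (n := 2) (by norm_num)).comp_tendsto h1
  exact this.trans_isBigO (Asymptotics.isBigO_of_le _ fun y => by simp)

/-- A uniform second-order Taylor estimate makes the gradient Lipschitz. -/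
theorem norm_sub_le_of_taylor {f : F → ℝ} {g : F → F} {K : ℝ}
    (h : ∀ x y, |f y - f x - inner ℝ (g x) (y - x)| ≤ K * ‖y - x‖ ^ 2) (x y : F) :
    ‖g x - g y‖ ≤ 6 * K * ‖x - y‖ := by
  rcases eq_or_ne (g x) (g y) with he | hne
  · rcases eq_or_ne x y with rfl | hxy
    · simp
    have hK : 0 ≤ K := nonneg_of_mul_nonneg_left ((abs_nonneg _).trans (h y x))
      (by have := norm_pos_iff.2 (sub_ne_zero.2 hxy); positivity)
    rw [he, sub_self, norm_zero]
    positivity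
  have hxy : x ≠ y := fun e => hne (by rw [e])
  set r := ‖x - y‖ with hr
  have hrpos : 0 < r := norm_pos_iff.2 (sub_ne_zero.2 hxy)
  set G := ‖g x - g y‖ with hG
  have hGpos : 0 < G := norm_pos_iff.2 (sub_ne_zero.2 hne)
  have hK : 0 ≤ K := nonneg_of_mul_nonneg_left ((abs_nonneg _).trans (h y x))
    (by rw [← hr]; positivity)
  -- A step of length `r` along `g x - g y`, so that the two gradients differ by exactly `r * G` on
  -- `v`. The Taylor errors for `(x, y + v)`, `(y, y + v)` and `(x, y)` are at most `4`, `1` and `1`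
  -- times `K * r ^ 2`, whence the constant `6`.
  set v : F := (r / G) • (g x - g y) with hv
  have hvn : ‖v‖ = r := by
    rw [hv, norm_smul, Real.norm_of_nonneg (by positivity), ← hG]
    field_simp
  have h1 := h x (y + v)
  have h2 := h y (y + v)
  have h3 := h x y
  have e1 : inner ℝ (g x) (y + v - x) = inner ℝ (g x) (y - x) + inner ℝ (g x) v := by
    rw [← inner_add_right]; congr 1; abel
  have e2 : inner ℝ (g x) v - inner ℝ (g y) v = r * G := by
    rw [← inner_sub_left, hv, inner_smul_right, real_inner_self_eq_norm_sq, ← hG]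
    field_simp
  have n1 : ‖y + v - x‖ ^ 2 ≤ (2 * r) ^ 2 := by
    gcongr
    calc ‖y + v - x‖ = ‖(y - x) + v‖ := by congr 1; abel
      _ ≤ ‖y - x‖ + ‖v‖ := norm_add_le _ _
      _ = 2 * r := by rw [hvn, norm_sub_rev, ← hr]; ring
  rw [norm_sub_rev, ← hr] at h3
  rw [add_sub_cancel_left, hvn] at h2
  rw [e1] at h1
  have h1' := h1.trans (mul_le_mul_of_nonneg_left n1 hK)
  have key : r * G ≤ 6 * K * r * r := by
    rw [abs_le] at h1' h2 h3
    nlinarith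
  nlinarith

end SecondOrder

/-! ### From regularity on Wasserstein space to regularity of the lift -/

section FromWasserstein

open Filter Topology

variable {d : ℕ}

/-- Distinct points of a finite set are uniformly separated. -/
theorem exists_separation {E : Type*} [NormedAddCommGroup E] {S : Set E} (hS : S.Finite) :
    ∃ δ : ℝ, 0 < δ ∧ ∀ a ∈ S, ∀ b ∈ S, a ≠ b → 2 * δ ≤ ‖a - b‖ := by
  have h : ∀ᶠ δ : ℝ in 𝓝[>] 0, ∀ a ∈ S, ∀ b ∈ S, a ≠ b → 2 * δ ≤ ‖a - b‖ := by
    refine (eventually_all_finite hS).2 fun a _ => (eventually_all_finite hS).2 fun b _ => ?_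
    by_cases hab : a = b
    · simp [hab]
    have hpos : 0 < ‖a - b‖ / 2 := by
      have := norm_pos_iff.2 (sub_ne_zero.2 hab)
      positivity
    filter_upwards [nhdsWithin_le_nhds (Iio_mem_nhds hpos)] with δ hδ _
    have : δ < ‖a - b‖ / 2 := hδ
    linarith
  obtain ⟨δ, hδ, hpos⟩ := (h.and self_mem_nhdsWithin).exists
  exact ⟨δ, hpos, hδ⟩

/-- An element of `ℍ` with values in a finite set. -/
def FinitelyValued (x : HilbertH d) : Prop :=
  ∃ S : Set (Eucl d), S.Finite ∧ ∀ᵐ ω ∂cubeMeasure d, x ω ∈ S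

/-- Around a finitely valued element of `ℍ`, uniformly small perturbations are optimal. -/
theorem FinitelyValued.exists_optimal {x : HilbertH d} (hx : FinitelyValued x) :
    ∃ δ : ℝ, 0 < δ ∧ ∀ y : HilbertH d, (∀ᵐ ω ∂cubeMeasure d, ‖x ω - y ω‖ ≤ δ) →
      (pairLaw x y ∈ optimalPlans (law x) (law y) ∧ W2 (law x) (law y) = ‖x - y‖) ∧
      (pairLaw y x ∈ optimalPlans (law y) (law x) ∧ W2 (law y) (law x) = ‖x - y‖) := by
  obtain ⟨S, hS, hxS⟩ := hx
  obtain ⟨δ, hδ, hsep⟩ := exists_separation hS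
  refine ⟨δ, hδ, fun y hy => pairLaw_optimal_of_infEDist hS.isClosed hxS ?_⟩
  filter_upwards [hxS, hy] with ω h1 h2 s hs
  -- The values of `x` are `2 * δ` apart, so a point within `δ` of one of them is no closer to any
  -- other.
  rcases eq_or_ne (x ω) s with rfl | hne
  · exact le_rfl
  have := hsep _ h1 s hs hne
  have := norm_sub_le_norm_sub_add_norm_sub (x ω) (y ω) s
  rw [norm_sub_rev (y ω) s] at this
  linarith

/-- Every element of `ℍ` is a limit of finitely valued ones whose joint laws with it are optimal. -/
theorem exists_finitelyValued_tendsto (x : HilbertH d) :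
    ∃ u : ℕ → HilbertH d, Tendsto u atTop (𝓝 x) ∧ ∀ n, FinitelyValued (u n) ∧
      pairLaw x (u n) ∈ optimalPlans (law x) (law (u n)) ∧
      W2 (law x) (law (u n)) = ‖u n - x‖ := by
  have hmx := measurable_coeFn_Lp x
  let a := SimpleFunc.approxOn x hmx Set.univ 0 (Set.mem_univ _)
  have ha : ∀ n, MemLp (a n) 2 (cubeMeasure d) := fun n =>
    SimpleFunc.memLp_approxOn hmx (Lp.memLp x) (Set.mem_univ _) MemLp.zero n
  refine ⟨fun n => (ha n).toLp (a n), ?_, fun n => ?_⟩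
  · rw [Lp.tendsto_Lp_iff_tendsto_eLpNorm']
    refine (SimpleFunc.tendsto_approxOn_Lp_eLpNorm hmx (Set.mem_univ 0) (p := 2) (by simp)
      (μ := cubeMeasure d) (by simp) (by simpa using Lp.eLpNorm_lt_top x)).congr fun n => ?_
    exact eLpNorm_congr_ae ((ha n).coeFn_toLp.symm.sub EventuallyEq.rfl)
  -- The sequence underlying `approxOn`: `a n ω` is a point nearest to `x ω` among `e 0, …, e n`,
  -- and this nearest-point property makes the plan optimal.
  · let e : ℕ → Eucl d := fun k => Nat.casesOn k 0
      (Subtype.val ∘ TopologicalSpace.denseSeq (Set.univ : Set (Eucl d)))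
    have hS : (e '' Set.Iic n).Finite := (Set.finite_Iic n).image e
    have hmem : ∀ ω, a n ω ∈ e '' Set.Iic n := fun ω =>
      ⟨SimpleFunc.nearestPtInd e n (x ω), SimpleFunc.nearestPtInd_le e n (x ω), rfl⟩
    have haS : ∀ᵐ ω ∂cubeMeasure d, (ha n).toLp (a n) ω ∈ e '' Set.Iic n := by
      filter_upwards [(ha n).coeFn_toLp] with ω hω
      rw [hω]
      exact hmem ω
    refine ⟨⟨_, hS, haS⟩, (pairLaw_optimal_of_infEDist hS.isClosed haS ?_).2⟩
    filter_upwards [(ha n).coeFn_toLp] with ω hω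
    rintro _ ⟨k, hk, rfl⟩
    rw [hω]
    have := SimpleFunc.edist_nearestPt_le e (x ω) (show k ≤ n from hk)
    rw [edist_eq_enorm_sub, edist_eq_enorm_sub] at this
    exact enorm_le_iff_norm_le.1 this

variable {U : P2 d → ℝ} {G : P2 d → Eucl d → Eucl d}

/-- The lift to `ℍ` of a gradient field. -/
def gradientLift (hG : ∀ μ, HasWassersteinGradientAt U μ (G μ)) (x : HilbertH d) : HilbertH d :=
  fieldComp x (G (law x)) (hG (law x)).1.1

theorem taylor_of_optimal (hG : ∀ μ, HasWassersteinGradientAt U μ (G μ)) {C : ℝ}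
    (hC : ∀ μ ν : P2 d, ∀ γ ∈ optimalPlans μ ν,
      |U ν - U μ - ∫ p, inner ℝ (G μ p.1) (p.2 - p.1) ∂γ| ≤ C * W2 μ ν ^ 2) {x y : HilbertH d}
    (hxy : pairLaw x y ∈ optimalPlans (law x) (law y)) (hW : W2 (law x) (law y) = ‖y - x‖) :
    |hilbertLift U y - hilbertLift U x - inner ℝ (gradientLift hG x) (y - x)| ≤
      C * ‖y - x‖ ^ 2 := by
  have := hC _ _ _ hxy
  rwa [integral_pairLaw (hG (law x)).1.1 (coeFn_fieldComp x (G (law x)) (hG (law x)).1.1), hW]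
    at this

/-- The pair `x`, `y` itself need not be optimally coupled; nearby points of the segment joining
them are, in both directions, and `abs_sub_sub_le_of_local_taylor` turns these local bounds into a
global one at the price of a factor `2`. -/
theorem taylor_of_finitelyValued (hG : ∀ μ, HasWassersteinGradientAt U μ (G μ)) {C : ℝ}
    (hC : ∀ μ ν : P2 d, ∀ γ ∈ optimalPlans μ ν,
      |U ν - U μ - ∫ p, inner ℝ (G μ p.1) (p.2 - p.1) ∂γ| ≤ C * W2 μ ν ^ 2) {x y : HilbertH d}
    (hx : FinitelyValued x) (hy : FinitelyValued y) :
    |hilbertLift U y - hilbertLift U x - inner ℝ (gradientLift hG x) (y - x)| ≤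
      2 * (C * ‖y - x‖ ^ 2) := by
  obtain ⟨S, hS, hxS⟩ := hx
  obtain ⟨T, hT, hyT⟩ := hy
  let z : ℝ → HilbertH d := fun t => x + t • (y - x)
  have hz : ∀ t, ∀ᵐ ω ∂cubeMeasure d, z t ω = x ω + t • (y ω - x ω) := by
    intro t
    filter_upwards [Lp.coeFn_add x (t • (y - x)), Lp.coeFn_smul t (y - x), Lp.coeFn_sub y x]
      with ω h1 h2 h3
    rw [h1, Pi.add_apply, h2, Pi.smul_apply, h3, Pi.sub_apply]
  have hfin : ∀ t, FinitelyValued (z t) := by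
    intro t
    refine ⟨Set.image2 (fun a b => a + t • (b - a)) S T, hS.image2 _ hT, ?_⟩
    filter_upwards [hxS, hyT, hz t] with ω h1 h2 h3
    rw [h3]
    exact Set.mem_image2_of_mem h1 h2
  -- Only finitely many displacements occur, so a small change of `t` is a uniformly small
  -- perturbation, as `FinitelyValued.exists_optimal` requires.
  obtain ⟨M, hM⟩ : ∃ M, ∀ c ∈ Set.image2 (fun a b : Eucl d => b - a) S T, ‖c‖ ≤ M :=
    (hS.image2 _ hT).isBounded.exists_norm_le
  have hsub : ∀ s t, z s - z t = (s - t) • (y - x) := by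
    intro s t
    simp only [z, sub_smul]
    abel
  have hopt : ∀ t₀, ∀ᶠ t in 𝓝 t₀,
      (pairLaw (z t₀) (z t) ∈ optimalPlans (law (z t₀)) (law (z t)) ∧
        W2 (law (z t₀)) (law (z t)) = ‖z t₀ - z t‖) ∧
      (pairLaw (z t) (z t₀) ∈ optimalPlans (law (z t)) (law (z t₀)) ∧
        W2 (law (z t)) (law (z t₀)) = ‖z t₀ - z t‖) := by
    intro t₀
    obtain ⟨δ, hδ, hopt⟩ := (hfin t₀).exists_optimal
    have hlim : Tendsto (fun t => |t₀ - t| * M) (𝓝 t₀) (𝓝 (|t₀ - t₀| * M)) := by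
      apply Continuous.tendsto
      fun_prop
    rw [sub_self, abs_zero, zero_mul] at hlim
    filter_upwards [hlim.eventually (ge_mem_nhds hδ)] with t ht
    refine hopt _ ?_
    filter_upwards [hz t, hz t₀, hxS, hyT] with ω h1 h2 h3 h4
    rw [h1, h2, add_sub_add_left_eq_sub, ← sub_smul, norm_smul, Real.norm_eq_abs]
    exact (mul_le_mul_of_nonneg_left (hM _ (Set.mem_image2_of_mem h3 h4)) (abs_nonneg _)).trans ht
  have key := abs_sub_sub_le_of_local_taylor (f := fun t => hilbertLift U (z t))
    (g := fun t => inner ℝ (gradientLift hG (z t)) (y - x)) (K := C * ‖y - x‖ ^ 2)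
    (fun t₀ => by
      filter_upwards [hopt t₀] with t ht
      have := taylor_of_optimal hG hC ht.1.1 (by rw [ht.1.2, norm_sub_rev])
      rw [hsub, inner_smul_right, norm_smul, mul_pow, Real.norm_eq_abs, sq_abs] at this
      convert this using 1
      · rw [mul_comm (t - t₀)]
      · ring)
    (fun t₀ => by
      filter_upwards [hopt t₀] with t ht
      have := taylor_of_optimal hG hC ht.2.1 ht.2.2
      rw [hsub, inner_smul_right, norm_smul, mul_pow, Real.norm_eq_abs, sq_abs] at this
      convert this using 1
      · rw [mul_comm (t₀ - t)]
      · ring)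
  simpa [z] using key

/-- Along an optimal joint law, the integral that tests continuity of the Wasserstein gradient is
the squared distance in `ℍ` between the lifted gradients. -/
theorem IsC1WassersteinWith.tendsto_gradientLift (h : IsC1WassersteinWith U G) {x : HilbertH d}
    {u : ℕ → HilbertH d} (hu : Tendsto u atTop (𝓝 x))
    (hopt : ∀ n, pairLaw x (u n) ∈ optimalPlans (law x) (law (u n)) ∧
      W2 (law x) (law (u n)) = ‖u n - x‖) :
    Tendsto (fun n => gradientLift h.1 (u n)) atTop (𝓝 (gradientLift h.1 x)) := by
  rw [Metric.tendsto_atTop']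
  intro ε hε
  obtain ⟨δ, hδ, hδ'⟩ := h.2 (law x) ((ε / 2) ^ 2) (by positivity)
  obtain ⟨N, hN⟩ := Metric.tendsto_atTop'.1 hu δ hδ
  refine ⟨N, fun n hn => ?_⟩
  have h1 := hδ' (law (u n)) (by rw [(hopt n).2, ← dist_eq_norm]; exact hN n hn) _ (hopt n).1
  rw [lintegral_pairLaw_sub (h.1 (law x)).1.1 (h.1 (law (u n))).1.1
    (coeFn_fieldComp x _ (h.1 (law x)).1.1) (coeFn_fieldComp (u n) _ (h.1 (law (u n))).1.1),
    ENNReal.ofReal_le_ofReal_iff (by positivity)] at h1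
  have h2 := abs_le_of_sq_le_sq h1 (by positivity)
  rw [abs_of_nonneg (norm_nonneg _)] at h2
  rw [dist_eq_norm]
  exact h2.trans_lt (by linarith)

/-- The approximants of `x` and of `y` are each optimally coupled to their own limit, which gives
convergence of values and gradients; the bound for the pair of approximants needs no optimality
between them. -/
theorem taylor_of_isC1 (h : IsC1WassersteinWith U G) {C : ℝ}
    (hC : ∀ μ ν : P2 d, ∀ γ ∈ optimalPlans μ ν,
      |U ν - U μ - ∫ p, inner ℝ (G μ p.1) (p.2 - p.1) ∂γ| ≤ C * W2 μ ν ^ 2) (x y : HilbertH d) :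
    |hilbertLift U y - hilbertLift U x - inner ℝ (gradientLift h.1 x) (y - x)| ≤
      2 * C * ‖y - x‖ ^ 2 := by
  have hlim : ∀ (x : HilbertH d) (u : ℕ → HilbertH d), Tendsto u atTop (𝓝 x) →
      (∀ n, pairLaw x (u n) ∈ optimalPlans (law x) (law (u n)) ∧
        W2 (law x) (law (u n)) = ‖u n - x‖) →
      Tendsto (fun n => hilbertLift U (u n)) atTop (𝓝 (hilbertLift U x)) := by
    intro x u hu hopt
    have h1 : Tendsto (fun n => u n - x) atTop (𝓝 0) := by
      simpa using hu.sub_const x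
    have h2 : Tendsto (fun n => inner ℝ (gradientLift h.1 x) (u n - x)) atTop (𝓝 0) := by
      simpa using tendsto_const_nhds (x := gradientLift h.1 x).inner h1
    have h3 : Tendsto (fun n => C * ‖u n - x‖ ^ 2) atTop (𝓝 0) := by
      simpa using (h1.norm.pow 2).const_mul C
    have h4 : Tendsto (fun n => hilbertLift U (u n) - hilbertLift U x -
        inner ℝ (gradientLift h.1 x) (u n - x)) atTop (𝓝 0) :=
      squeeze_zero_norm (fun n => taylor_of_optimal h.1 hC (hopt n).1 (hopt n).2) h3
    have h5 := (h4.add h2).add_const (hilbertLift U x)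
    simpa using h5
  obtain ⟨u, hu, hu'⟩ := exists_finitelyValued_tendsto x
  obtain ⟨v, hv, hv'⟩ := exists_finitelyValued_tendsto y
  have hfx := hlim x u hu fun n => (hu' n).2
  have hfy := hlim y v hv fun n => (hv' n).2
  have hg := h.tendsto_gradientLift hu fun n => (hu' n).2
  refine le_of_tendsto_of_tendsto (((hfy.sub hfx).sub (hg.inner (hv.sub hu))).abs)
    (((hv.sub hu).norm.pow 2).const_mul (2 * C)) (Eventually.of_forall fun n => ?_)
  have := taylor_of_finitelyValued h.1 hC (hu' n).1 (hv' n).1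
  rwa [← mul_assoc] at this

theorem IsC11Wasserstein.isC11H (h : IsC11Wasserstein U) : IsC11H (hilbertLift U) := by
  obtain ⟨G, hG, C, hC, -, hT⟩ := h
  have ht := taylor_of_isC1 hG hT
  have hgrad : ∀ x, gradient (hilbertLift U) x = gradientLift hG.1 x := fun x =>
    (hasGradientAt_of_taylor ht x).gradient
  -- The added `1` keeps the constant strictly positive when `C = 0`.
  refine ⟨6 * (2 * C) + 1, by positivity,
    fun x => (hasGradientAt_of_taylor ht x).differentiableAt, fun x y => ?_⟩
  rw [hgrad, hgrad]
  have := norm_sub_le_of_taylor ht x y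
  nlinarith [norm_nonneg (x - y)]

end FromWasserstein

/-! ### Realizing measures and plans as laws on the cube -/

section Realization

variable {d : ℕ}

theorem unitCube_eq_preimage (d : ℕ) : unitCube d =
    (WithLp.ofLp : Eucl d → Fin d → ℝ) ⁻¹' (Set.univ.pi fun _ => Set.Ioo (0 : ℝ) 1) := by
  ext ω
  simp [unitCube]

theorem isOpen_unitCube (d : ℕ) : IsOpen (unitCube d) := by
  rw [unitCube_eq_preimage]
  exact (isOpen_set_pi Set.finite_univ fun _ _ => isOpen_Ioo).preimage
    (PiLp.continuous_ofLp 2 _)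

/-- Each coordinate of the cube is uniformly distributed. -/
theorem measurePreserving_coord (i : Fin d) :
    MeasurePreserving (fun ω : Eucl d => ω i) (cubeMeasure d)
      (volume.restrict (Set.Ioo (0 : ℝ) 1)) := by
  have h1 : MeasurePreserving (WithLp.ofLp : Eucl d → Fin d → ℝ) (cubeMeasure d)
      ((volume : Measure (Fin d → ℝ)).restrict (Set.univ.pi fun _ => Set.Ioo (0 : ℝ) 1)) := by
    rw [cubeMeasure, unitCube_eq_preimage]
    exact (PiLp.volume_preserving_ofLp (Fin d)).restrict_preimage
      (MeasurableSet.univ_pi fun _ => measurableSet_Ioo)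
  rw [volume_pi, Measure.restrict_pi_pi] at h1
  have : IsProbabilityMeasure (volume.restrict (Set.Ioo (0 : ℝ) 1)) := ⟨by simp⟩
  exact (measurePreserving_eval (fun _ : Fin d => volume.restrict (Set.Ioo (0 : ℝ) 1)) i).comp h1

/-- Every law on a standard Borel space is the law of a random variable on a cube of positive
dimension. -/
theorem exists_measurable_map_cubeMeasure_eq {Y : Type*} [Nonempty Y] [MeasurableSpace Y]
    [StandardBorelSpace Y] (i : Fin d) (ρ : Measure Y) [IsProbabilityMeasure ρ] :
    ∃ Z : Eucl d → Y, Measurable Z ∧ (cubeMeasure d).map Z = ρ := by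
  obtain ⟨f, hf, hρ⟩ := Measure.exists_measurable_map_eq ρ
  -- `Set.projIcc` merely retypes a coordinate as a point of `unitInterval`, since almost every
  -- coordinate already lies there.
  have hproj : Measurable (Set.projIcc (0 : ℝ) 1 zero_le_one) := continuous_projIcc.measurable
  have hI : (volume.restrict (Set.Ioo (0 : ℝ) 1)).map (Set.projIcc (0 : ℝ) 1 zero_le_one) =
      (volume : Measure unitInterval) := by
    rw [Measure.restrict_congr_set Ioo_ae_eq_Icc, ← map_comap_subtype_coe measurableSet_Icc,
      Measure.map_map hproj measurable_subtype_coe]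
    have hid : Set.projIcc (0 : ℝ) 1 zero_le_one ∘ Subtype.val = id := by
      ext t
      simp
    rw [hid, Measure.map_id]
    rfl
  refine ⟨fun ω => f (Set.projIcc 0 1 zero_le_one (ω i)),
    hf.comp (hproj.comp (measurePreserving_coord i).measurable), ?_⟩
  rw [← hρ, ← hI, ← (measurePreserving_coord i).map_eq,
    Measure.map_map hproj (measurePreserving_coord i).measurable,
    Measure.map_map hf (hproj.comp (measurePreserving_coord i).measurable)]
  rfl

theorem memLp_of_map_eq (μ : P2 d) {X : Eucl d → Eucl d} (hX : Measurable X)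
    (h : (cubeMeasure d).map X = μ.toMeasure) : MemLp X 2 (cubeMeasure d) := by
  refine ⟨hX.aestronglyMeasurable, ?_⟩
  rw [eLpNorm_lt_top_iff_lintegral_rpow_enorm_lt_top (by norm_num) (by norm_num)]
  have := μ.secondMoment_lt_top
  rw [← h, lintegral_map (by fun_prop) hX] at this
  simpa using this

theorem law_toLp (μ : P2 d) {X : Eucl d → Eucl d} (hX : Measurable X)
    (h : (cubeMeasure d).map X = μ.toMeasure) : law ((memLp_of_map_eq μ hX h).toLp X) = μ := by
  ext1
  rw [← h]
  exact Measure.map_congr (MemLp.coeFn_toLp _)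

theorem exists_law_eq [NeZero d] (μ : P2 d) : ∃ x : HilbertH d, law x = μ := by
  obtain ⟨X, hX, h⟩ := exists_measurable_map_cubeMeasure_eq (0 : Fin d) μ.toMeasure
  exact ⟨_, law_toLp μ hX h⟩

/-- The plan is a law on the standard Borel space `ℝ^d × ℝ^d`, hence the law of one map `Z` on the
cube; `x` and `y` are the components of `Z`. -/
theorem exists_pairLaw_eq [NeZero d] {μ ν : P2 d} {γ : Measure (Eucl d × Eucl d)}
    (hγ : γ ∈ couplings μ ν) :
    ∃ x y : HilbertH d, law x = μ ∧ law y = ν ∧ pairLaw x y = γ := by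
  have : IsProbabilityMeasure γ := by
    refine ⟨?_⟩
    have h : γ.map Prod.fst Set.univ = 1 := by rw [hγ.1]; exact measure_univ
    rwa [Measure.map_apply measurable_fst MeasurableSet.univ, Set.preimage_univ] at h
  obtain ⟨Z, hZ, h⟩ := exists_measurable_map_cubeMeasure_eq (0 : Fin d) γ
  have h1 : (cubeMeasure d).map (fun ω => (Z ω).1) = μ.toMeasure := by
    rw [← hγ.1, ← h, Measure.map_map measurable_fst hZ]
    rfl
  have h2 : (cubeMeasure d).map (fun ω => (Z ω).2) = ν.toMeasure := by
    rw [← hγ.2, ← h, Measure.map_map measurable_snd hZ]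
    rfl
  refine ⟨_, _, law_toLp μ hZ.fst h1, law_toLp ν hZ.snd h2, ?_⟩
  rw [pairLaw, ← h]
  refine Measure.map_congr ?_
  filter_upwards [(memLp_of_map_eq μ hZ.fst h1).coeFn_toLp,
    (memLp_of_map_eq ν hZ.snd h2).coeFn_toLp] with ω e1 e2
  rw [e1, e2]

/-- An optimal plan is the joint law of two elements of `ℍ` at distance `W₂`. -/
theorem exists_pairLaw_eq_of_optimal [NeZero d] {μ ν : P2 d} {γ : Measure (Eucl d × Eucl d)}
    (hγ : γ ∈ optimalPlans μ ν) :
    ∃ x y : HilbertH d, law x = μ ∧ law y = ν ∧ pairLaw x y = γ ∧ ‖y - x‖ = W2 μ ν := by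
  obtain ⟨x, y, hx, hy, rfl⟩ := exists_pairLaw_eq hγ.1
  refine ⟨x, y, hx, hy, rfl, ?_⟩
  have h := hγ.2
  rw [transportCost_pairLaw, ENNReal.ofReal_eq_ofReal_iff (by positivity) (by positivity)] at h
  rw [norm_sub_rev]
  exact (pow_left_inj₀ (norm_nonneg _) (W2_nonneg _ _) two_ne_zero).1 h

end Realization

/-! ### Exchanging a set with its translate -/

section Swap

variable {d : ℕ}

/-- The map exchanging `A` and `A + v` by translation. -/
def translationSwap (A : Set (Eucl d)) (v : Eucl d) (ω : Eucl d) : Eucl d :=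
  open Classical in if ω ∈ A then ω + v else if ω - v ∈ A then ω - v else ω

theorem translationSwap_of_mem {A : Set (Eucl d)} {v ω : Eucl d} (h : ω ∈ A) :
    translationSwap A v ω = ω + v := by
  simp [translationSwap, h]

theorem translationSwap_of_sub_mem {A : Set (Eucl d)} {v ω : Eucl d}
    (hd : ∀ ω ∈ A, ω + v ∉ A) (h : ω - v ∈ A) : translationSwap A v ω = ω - v := by
  have : ω ∉ A := by simpa using hd _ h
  simp [translationSwap, h, this]

theorem translationSwap_of_notMem {A : Set (Eucl d)} {v ω : Eucl d} (h : ω ∉ A) (h' : ω - v ∉ A) :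
    translationSwap A v ω = ω := by
  simp [translationSwap, h, h']

theorem translationSwap_involutive {A : Set (Eucl d)} {v : Eucl d} (hd : ∀ ω ∈ A, ω + v ∉ A) :
    Function.Involutive (translationSwap A v) := by
  intro ω
  by_cases h : ω ∈ A
  · rw [translationSwap_of_mem h, translationSwap_of_sub_mem hd (by simpa using h)]
    simp
  by_cases h' : ω - v ∈ A
  · rw [translationSwap_of_sub_mem hd h', translationSwap_of_mem h']
    simp
  · rw [translationSwap_of_notMem h h', translationSwap_of_notMem h h']

theorem measurable_translationSwap {A : Set (Eucl d)} (hA : MeasurableSet A) (v : Eucl d) :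
    Measurable (translationSwap A v) := by
  classical
  have h2 : MeasurableSet {ω : Eucl d | ω - v ∈ A} := (measurable_id.sub_const v) hA
  have : translationSwap A v = fun ω => if ω ∈ A then ω + v else if ω - v ∈ A then ω - v else ω := by
    ext1 ω
    simp only [translationSwap]
  rw [this]
  exact Measurable.ite hA (measurable_id.add_const v)
    (Measurable.ite h2 (measurable_id.sub_const v) measurable_id)

/-- `A` and its translate are disjoint; the swap translates each onto the other and fixes the rest,
so volume is preserved piece by piece. -/
theorem volume_preserving_translationSwap {A : Set (Eucl d)} (hA : MeasurableSet A) {v : Eucl d}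
    (hd : ∀ ω ∈ A, ω + v ∉ A) : MeasurePreserving (translationSwap A v) volume volume := by
  have hm := measurable_translationSwap hA v
  refine ⟨hm, ?_⟩
  ext B hB
  rw [Measure.map_apply hm hB]
  set A' : Set (Eucl d) := (fun ω => ω - v) ⁻¹' A with hA'
  have hmA' : MeasurableSet A' := (measurable_id.sub_const v) hA
  have hsplit : ∀ D : Set (Eucl d), MeasurableSet D →
      volume D = volume (D ∩ A) + (volume (D ∩ A') + volume ((D \ A) \ A')) := by
    intro D hD
    rw [← measure_inter_add_sdiff D hA, ← measure_inter_add_sdiff (D \ A) hmA']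
    congr 3
    ext ω
    simp only [Set.mem_inter_iff, Set.mem_sdiff]
    refine ⟨fun h => ⟨h.1.1, h.2⟩, fun h => ⟨⟨h.1, ?_⟩, h.2⟩⟩
    simpa using hd _ h.2
  have e1 : volume (translationSwap A v ⁻¹' B ∩ A) = volume (B ∩ A') := by
    rw [← measure_preimage_add_right volume v (B ∩ A')]
    congr 1
    ext ω
    simp only [Set.mem_inter_iff, Set.mem_preimage, hA', add_sub_cancel_right]
    exact and_congr_left fun h => by rw [translationSwap_of_mem h]
  have e2 : volume (translationSwap A v ⁻¹' B ∩ A') = volume (B ∩ A) := by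
    rw [← measure_preimage_add_right volume (-v) (B ∩ A)]
    congr 1
    ext ω
    simp only [Set.mem_inter_iff, Set.mem_preimage, hA', ← sub_eq_add_neg]
    exact and_congr_left fun h => by rw [translationSwap_of_sub_mem hd h]
  have e3 : (translationSwap A v ⁻¹' B \ A) \ A' = (B \ A) \ A' := by
    ext ω
    simp only [Set.mem_sdiff, Set.mem_preimage, hA']
    refine ⟨fun h => ⟨⟨?_, h.1.2⟩, h.2⟩, fun h => ⟨⟨?_, h.1.2⟩, h.2⟩⟩
    · have := h.1.1
      rwa [translationSwap_of_notMem h.1.2 h.2] at this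
    · rw [translationSwap_of_notMem h.1.2 h.2]
      exact h.1.1
  rw [hsplit _ (hm hB), hsplit _ hB, e1, e2, e3]
  ring

theorem measurePreserving_translationSwap {A : Set (Eucl d)} (hA : MeasurableSet A) {v : Eucl d}
    (hd : ∀ ω ∈ A, ω + v ∉ A) (h₁ : A ⊆ unitCube d) (h₂ : ∀ ω ∈ A, ω + v ∈ unitCube d) :
    MeasurePreserving (translationSwap A v) (cubeMeasure d) (cubeMeasure d) := by
  have h := (volume_preserving_translationSwap hA hd).restrict_preimage
    (isOpen_unitCube d).measurableSet
  have hsub : ∀ ω ∈ unitCube d, translationSwap A v ω ∈ unitCube d := by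
    intro ω hω
    by_cases h : ω ∈ A
    · rw [translationSwap_of_mem h]
      exact h₂ _ h
    by_cases h' : ω - v ∈ A
    · rw [translationSwap_of_sub_mem hd h']
      exact h₁ h'
    · rwa [translationSwap_of_notMem h h']
  have hpre : translationSwap A v ⁻¹' unitCube d = unitCube d := by
    refine Set.Subset.antisymm (fun ω hω => ?_) hsub
    have := hsub _ hω
    rwa [translationSwap_involutive hd] at this
  rwa [hpre] at h

end Swap

/-! ### Invariance of the lift under rearrangements -/

section Equivariance

variable {d : ℕ} {U : P2 d → ℝ}

theorem law_compMeasurePreserving {T : Eucl d → Eucl d}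
    (hT : MeasurePreserving T (cubeMeasure d) (cubeMeasure d)) (x : HilbertH d) :
    law (Lp.compMeasurePreserving T hT x) = law x := by
  ext1
  change (cubeMeasure d).map _ = (cubeMeasure d).map x
  rw [Measure.map_congr (Lp.coeFn_compMeasurePreserving x hT),
    ← Measure.map_map (measurable_coeFn_Lp x) hT.measurable, hT.map_eq]

/-- The gradient of the lift of `U`. -/
def liftGradient (U : P2 d → ℝ) (x : HilbertH d) : HilbertH d := gradient (hilbertLift U) x

theorem hasGradientAt_liftGradient (hU : Differentiable ℝ (hilbertLift U)) (x : HilbertH d) :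
    HasGradientAt (hilbertLift U) (liftGradient U x) x :=
  (hU x).hasGradientAt

/-- The gradient of a lift commutes with measure-preserving involutions. -/
theorem liftGradient_comp (hU : Differentiable ℝ (hilbertLift U)) {T : Eucl d → Eucl d}
    (hT : MeasurePreserving T (cubeMeasure d) (cubeMeasure d)) (hinv : Function.Involutive T)
    (x : HilbertH d) :
    liftGradient U (Lp.compMeasurePreserving T hT x) =
      Lp.compMeasurePreserving T hT (liftGradient U x) := by
  let τ : HilbertH d →ₗᵢ[ℝ] HilbertH d := Lp.compMeasurePreservingₗᵢ ℝ T hT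
  have hττ : ∀ y, τ (τ y) = y := by
    intro y
    apply Lp.ext
    filter_upwards [Lp.coeFn_compMeasurePreserving (τ y) hT,
      hT.quasiMeasurePreserving.ae_eq_comp (Lp.coeFn_compMeasurePreserving y hT)] with ω h1 h2
    refine h1.trans (h2.trans ?_)
    simp [hinv ω]
  have hlift : hilbertLift U ∘ τ = hilbertLift U := by
    ext y
    exact congrArg U (law_compMeasurePreserving hT y)
  have hcomp := (hasGradientAt_liftGradient hU (τ x)).hasFDerivAt.comp x
    τ.toContinuousLinearMap.hasFDerivAt
  have hx := (hasGradientAt_liftGradient hU x).hasFDerivAt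
  change HasFDerivAt (hilbertLift U ∘ τ) _ x at hcomp
  rw [hlift] at hcomp
  have huniq := hcomp.unique hx
  change liftGradient U (τ x) = τ (liftGradient U x)
  -- The chain rule equates the pairing of the gradient at `τ x` with `τ z` and that of the gradient
  -- at `x` with `z`. Taking `z = τ w` and using `τ ∘ τ = id` leaves `w` on the left; the isometry
  -- then carries `τ` over to the gradient at `x`.
  refine ext_inner_right ℝ fun w => ?_
  have := congrArg (fun l => l (τ w)) huniq
  simp only [ContinuousLinearMap.comp_apply, InnerProductSpace.toDual_apply_apply,
    LinearIsometry.coe_toContinuousLinearMap, hττ] at this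
  rw [this, ← τ.inner_map_map, hττ]

end Equivariance

/-! ### The gradient of the lift as a Lipschitz field -/

section GradientField

open Filter Topology

variable {d : ℕ} {U : P2 d → ℝ} {C : ℝ}

/-- Two sets of positive measure meet after a suitable translation. -/
theorem exists_translate_inter_ne_zero {A B : Set (Eucl d)} (hA : MeasurableSet A)
    (hB : MeasurableSet B) (hA0 : volume A ≠ 0) (hB0 : volume B ≠ 0) :
    ∃ v : Eucl d, volume (A ∩ (fun ω => ω + v) ⁻¹' B) ≠ 0 := by
  by_contra! h
  -- The shear `(ω, v) ↦ (ω, ω + v)` preserves volume, so by Fubini the overlaps over all `v`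
  -- integrate to the product of the volumes of `A` and `B`.
  have hmp := measurePreserving_prod_add (volume : Measure (Eucl d)) (volume : Measure (Eucl d))
  have h1 := hmp.measure_preimage (hA.prod hB).nullMeasurableSet
  rw [Measure.prod_prod, Measure.prod_apply_symm (hmp.measurable (hA.prod hB))] at h1
  have h2 : ∀ v : Eucl d, volume ((fun ω => (ω, v)) ⁻¹'
      ((fun z : Eucl d × Eucl d => (z.1, z.1 + z.2)) ⁻¹' (A ×ˢ B))) = 0 := fun v => h v
  simp only [h2, lintegral_zero] at h1
  exact mul_ne_zero hA0 hB0 h1.symm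

theorem ofReal_norm_comp_sub_sq {T : Eucl d → Eucl d}
    (hT : MeasurePreserving T (cubeMeasure d) (cubeMeasure d)) (z : HilbertH d) :
    ENNReal.ofReal (‖Lp.compMeasurePreserving T hT z - z‖ ^ 2) =
      ∫⁻ ω, ‖z (T ω) - z ω‖ₑ ^ 2 ∂cubeMeasure d := by
  rw [ofReal_norm_sub_sq_Lp]
  refine lintegral_congr_ae ?_
  filter_upwards [Lp.coeFn_compMeasurePreserving z hT] with ω h
  rw [h, Function.comp_apply]

theorem IsC11WithH.norm_liftGradient_sub_le (hU : IsC11WithH C (hilbertLift U))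
    (x y : HilbertH d) : ‖liftGradient U x - liftGradient U y‖ ≤ C * ‖x - y‖ := hU.2 x y

/-- The gradient of a lift does not oscillate more than its base point under measure-preserving
involutions. -/
theorem IsC11WithH.lintegral_comp_sub_le (hU : IsC11WithH C (hilbertLift U)) {T : Eucl d → Eucl d}
    (hT : MeasurePreserving T (cubeMeasure d) (cubeMeasure d)) (hinv : Function.Involutive T)
    (x : HilbertH d) :
    ∫⁻ ω, ‖liftGradient U x (T ω) - liftGradient U x ω‖ₑ ^ 2 ∂cubeMeasure d ≤
      ∫⁻ ω, ENNReal.ofReal (C ^ 2) * ‖x (T ω) - x ω‖ₑ ^ 2 ∂cubeMeasure d := by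
  have hlip := hU.norm_liftGradient_sub_le (Lp.compMeasurePreserving T hT x) x
  rw [liftGradient_comp hU.1 hT hinv] at hlip
  rw [lintegral_const_mul' _ _ ENNReal.ofReal_ne_top, ← ofReal_norm_comp_sub_sq hT,
    ← ofReal_norm_comp_sub_sq hT, ← ENNReal.ofReal_mul (sq_nonneg C), ← mul_pow]
  exact ENNReal.ofReal_le_ofReal (pow_le_pow_left₀ (norm_nonneg _) hlip 2)

theorem ofReal_sq_mul_enorm_sq_lt (hC : 0 ≤ C) {a b : Eucl d} (hab : C * ‖a‖ < ‖b‖) :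
    ENNReal.ofReal (C ^ 2) * ‖a‖ₑ ^ 2 < ‖b‖ₑ ^ 2 := by
  rw [← ofReal_norm, ← ofReal_norm, ← ENNReal.ofReal_pow (norm_nonneg _),
    ← ENNReal.ofReal_pow (norm_nonneg _), ← ENNReal.ofReal_mul (sq_nonneg C), ← mul_pow]
  have h0 : 0 ≤ C * ‖a‖ := by positivity
  exact (ENNReal.ofReal_lt_ofReal_iff (by nlinarith)).2 (pow_lt_pow_left₀ hab h0 two_ne_zero)

/-- A set on which the gradient of a lift violates the Lipschitz bound along a translation is
null. -/
theorem IsC11WithH.volume_eq_zero_of_lt (hU : IsC11WithH C (hilbertLift U)) (hC : 0 ≤ C)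
    (x : HilbertH d) {A : Set (Eucl d)} (hA : MeasurableSet A) {v : Eucl d}
    (hd : ∀ ω ∈ A, ω + v ∉ A) (h₁ : A ⊆ unitCube d) (h₂ : ∀ ω ∈ A, ω + v ∈ unitCube d)
    (hlt : ∀ ω ∈ A, C * ‖x ω - x (ω + v)‖ < ‖liftGradient U x ω - liftGradient U x (ω + v)‖) :
    volume A = 0 := by
  by_contra hA0
  have hT := measurePreserving_translationSwap hA hd h₁ h₂
  have hle := hU.lintegral_comp_sub_le hT (translationSwap_involutive hd) x
  generalize liftGradient U x = L at hle hlt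
  -- The violation is symmetric under the swap: strict on `A` and on its translate, with both sides
  -- zero elsewhere. Integration contradicts `hle`.
  have hltA : ∀ ω ∈ A, ENNReal.ofReal (C ^ 2) * ‖x (translationSwap A v ω) - x ω‖ₑ ^ 2 <
      ‖L (translationSwap A v ω) - L ω‖ₑ ^ 2 := by
    intro ω h
    apply ofReal_sq_mul_enorm_sq_lt hC
    rw [translationSwap_of_mem h, norm_sub_rev, norm_sub_rev (L _)]
    exact hlt _ h
  have hltA' : ∀ ω, ω - v ∈ A → ENNReal.ofReal (C ^ 2) * ‖x (translationSwap A v ω) - x ω‖ₑ ^ 2 <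
      ‖L (translationSwap A v ω) - L ω‖ₑ ^ 2 := by
    intro ω h
    apply ofReal_sq_mul_enorm_sq_lt hC
    rw [translationSwap_of_sub_mem hd h]
    simpa using hlt _ h
  have hA0' : cubeMeasure d A ≠ 0 := by
    rwa [cubeMeasure, Measure.restrict_apply hA, Set.inter_eq_left.2 h₁]
  have hLm := measurable_coeFn_Lp L
  have hTm := hT.measurable
  have hmeas : Measurable fun ω => ‖L (translationSwap A v ω) - L ω‖ₑ ^ 2 :=
    (((hLm.comp hTm).sub hLm).enorm).pow_const 2
  refine absurd hle (not_le.2 (lintegral_strict_mono_of_ae_le_of_ae_lt_on (s := A)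
    hmeas.aemeasurable ?_ (Eventually.of_forall fun ω => ?_) hA0' (Eventually.of_forall hltA)))
  · rw [lintegral_const_mul' _ _ ENNReal.ofReal_ne_top, ← ofReal_norm_comp_sub_sq hT]
    exact ENNReal.mul_ne_top ENNReal.ofReal_ne_top ENNReal.ofReal_ne_top
  · by_cases h : ω ∈ A
    · exact (hltA ω h).le
    by_cases h' : ω - v ∈ A
    · exact (hltA' ω h').le
    · simp only [translationSwap_of_notMem h h', sub_self]
      simp

/-- A strict failure of a Lipschitz bound persists in a neighbourhood. -/
theorem exists_isOpen_lt_norm_sub {E : Type*} [NormedAddCommGroup E] {C : ℝ} {p q : E × E}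
    (h : C * ‖p.1 - q.1‖ < ‖p.2 - q.2‖) :
    ∃ M N : Set (E × E), IsOpen M ∧ p ∈ M ∧ IsOpen N ∧ q ∈ N ∧
      ∀ a ∈ M, ∀ b ∈ N, C * ‖a.1 - b.1‖ < ‖a.2 - b.2‖ := by
  have hopen : IsOpen {r : (E × E) × E × E | C * ‖r.1.1 - r.2.1‖ < ‖r.1.2 - r.2.2‖} :=
    isOpen_lt (by fun_prop) (by fun_prop)
  have hmem : {r : (E × E) × E × E | C * ‖r.1.1 - r.2.1‖ < ‖r.1.2 - r.2.2‖} ∈ 𝓝 (p, q) :=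
    hopen.mem_nhds h
  obtain ⟨M, N, hM, hpM, hN, hqN, hMN⟩ := mem_nhds_prod_iff'.1 hmem
  exact ⟨M, N, hM, hpM, hN, hqN, fun a ha b hb => hMN (Set.mk_mem_prod ha hb)⟩

theorem cubeMeasure_apply {A : Set (Eucl d)} (hA : MeasurableSet A) :
    cubeMeasure d A = volume (unitCube d ∩ A) := by
  rw [cubeMeasure, Measure.restrict_apply hA, Set.inter_comm]

theorem measurableSet_unitCube_inter_pair (x y : HilbertH d) {D : Set (Eucl d × Eucl d)}
    (hD : IsOpen D) : MeasurableSet (unitCube d ∩ {ω | (x ω, y ω) ∈ D}) :=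
  (isOpen_unitCube d).measurableSet.inter (measurable_pair x y hD.measurableSet)

theorem volume_ne_zero_of_mem_support (x y : HilbertH d) {D : Set (Eucl d × Eucl d)}
    (hD : IsOpen D) {r : Eucl d × Eucl d} (hr : r ∈ D) (hrs : r ∈ (pairLaw x y).support) :
    volume (unitCube d ∩ {ω | (x ω, y ω) ∈ D}) ≠ 0 := by
  have h := (Measure.mem_support_iff_forall r).1 hrs D (hD.mem_nhds hr)
  rw [pairLaw, Measure.map_apply (measurable_pair x y) hD.measurableSet,
    cubeMeasure_apply (measurable_pair x y hD.measurableSet)] at h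
  exact h.ne'

/-- The joint law of `x` and the gradient of a lift at `x` is carried by a Lipschitz graph. -/
theorem IsC11WithH.norm_sub_le_of_mem_support (hU : IsC11WithH C (hilbertLift U)) (hC : 0 ≤ C)
    (x : HilbertH d) {p q : Eucl d × Eucl d}
    (hp : p ∈ (pairLaw x (liftGradient U x)).support)
    (hq : q ∈ (pairLaw x (liftGradient U x)).support) :
    ‖p.2 - q.2‖ ≤ C * ‖p.1 - q.1‖ := by
  refine le_of_not_gt fun hlt => ?_
  obtain ⟨M, N, hM, hpM, hN, hqN, hMN⟩ := exists_isOpen_lt_norm_sub hlt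
  have hmM := measurableSet_unitCube_inter_pair x (liftGradient U x) hM
  have hmN := measurableSet_unitCube_inter_pair x (liftGradient U x) hN
  obtain ⟨v, hv⟩ := exists_translate_inter_ne_zero hmM hmN
    (volume_ne_zero_of_mem_support x _ hM hpM hp) (volume_ne_zero_of_mem_support x _ hN hqN hq)
  have hlt' : ∀ ω ω', ω ∈ unitCube d ∩ {ω | (x ω, liftGradient U x ω) ∈ M} →
      ω' ∈ unitCube d ∩ {ω | (x ω, liftGradient U x ω) ∈ N} →
      C * ‖x ω - x ω'‖ < ‖liftGradient U x ω - liftGradient U x ω'‖ := fun ω ω' h h' =>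
    hMN (x ω, liftGradient U x ω) h.2 (x ω', liftGradient U x ω') h'.2
  refine hv (hU.volume_eq_zero_of_lt hC x (hmM.inter (hmN.preimage (measurable_add_const v)))
    (v := v) ?_ ?_ ?_ ?_)
  -- If `ω + v` were also in the set, it would belong to both the `M` part and the `N` part, and the
  -- strict inequality between it and itself would read `0 < 0`.
  · intro ω h h'
    have := hlt' _ _ h'.1 h.2
    rw [sub_self, sub_self, norm_zero, mul_zero] at this
    exact lt_irrefl _ this
  · exact fun ω h => h.1.1
  · exact fun ω h => h.2.1
  · exact fun ω h => hlt' _ _ h.1 h.2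

/-- A Lipschitz graph is the graph of a continuous function. -/
theorem exists_continuous_of_lipschitz_graph {E : Type*} [NormedAddCommGroup E] [NormedSpace ℝ E]
    [FiniteDimensional ℝ E] {C : ℝ} (hC : 0 ≤ C) {S : Set (E × E)}
    (hle : ∀ p ∈ S, ∀ q ∈ S, ‖p.2 - q.2‖ ≤ C * ‖p.1 - q.1‖) :
    ∃ ξ : E → E, Continuous ξ ∧ (∀ q ∈ closure (Prod.fst '' S), ∀ q' ∈ closure (Prod.fst '' S),
      ‖ξ q - ξ q'‖ ≤ C * ‖q - q'‖) ∧ ∀ p ∈ S, p.2 = ξ p.1 := by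
  have hch : ∀ q ∈ Prod.fst '' S, ∃ p, (q, p) ∈ S := by
    rintro _ ⟨p, hp, rfl⟩
    exact ⟨p.2, hp⟩
  choose! f hf using hch
  have hlip : LipschitzOnWith C.toNNReal f (Prod.fst '' S) := by
    refine LipschitzOnWith.of_dist_le_mul fun a ha b hb => ?_
    rw [dist_eq_norm, dist_eq_norm, Real.coe_toNNReal _ hC]
    exact hle _ (hf a ha) _ (hf b hb)
  -- The extension to the whole space may have a larger Lipschitz constant; `C` is recovered only on
  -- the closure of the projection, by continuity.
  obtain ⟨ξ, hξ, hfξ⟩ := hlip.extend_finite_dimension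
  refine ⟨ξ, hξ.continuous, fun q hq q' hq' => ?_, fun p hp => ?_⟩
  · have hcl : LipschitzOnWith C.toNNReal ξ (closure (Prod.fst '' S)) :=
      LipschitzOnWith.closure hξ.continuous.continuousOn (fun a ha b hb => by
        rw [← hfξ ha, ← hfξ hb]
        exact hlip ha hb)
    have := hcl.dist_le_mul q hq q' hq'
    rwa [dist_eq_norm, dist_eq_norm, Real.coe_toNNReal _ hC] at this
  · have h1 : p.1 ∈ Prod.fst '' S := ⟨_, hp, rfl⟩
    have h2 := hle _ hp _ (hf _ h1)
    rw [sub_self, norm_zero, mul_zero] at h2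
    rw [← hfξ h1]
    exact sub_eq_zero.1 (norm_le_zero_iff.1 h2)

/-- The gradient of a lift at `x` is a Lipschitz function of `x`. -/
theorem IsC11WithH.exists_field (hU : IsC11WithH C (hilbertLift U)) (hC : 0 ≤ C)
    (x : HilbertH d) : ∃ ξ : Eucl d → Eucl d, Continuous ξ ∧ LipschitzOnSupport C (law x) ξ ∧
      liftGradient U x =ᵐ[cubeMeasure d] fun ω => ξ (x ω) := by
  obtain ⟨ξ, hξ, hlip, hgraph⟩ := exists_continuous_of_lipschitz_graph hC
    fun p hp q hq => hU.norm_sub_le_of_mem_support hC x (p := p) (q := q) hp hq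
  have hmem : ∀ᵐ ω ∂cubeMeasure d,
      (x ω, liftGradient U x ω) ∈ (pairLaw x (liftGradient U x)).support :=
    ae_of_ae_map (measurable_pair x _).aemeasurable Measure.support_mem_ae
  have hsupp : (law x).toMeasure.support ⊆
      closure (Prod.fst '' (pairLaw x (liftGradient U x)).support) := by
    refine Measure.support_subset_of_isClosed isClosed_closure ?_
    refine (ae_map_iff (measurable_coeFn_Lp x).aemeasurable isClosed_closure.measurableSet).2 ?_
    filter_upwards [hmem] with ω h
    exact subset_closure ⟨_, h, rfl⟩
  refine ⟨ξ, hξ, fun q hq q' hq' => hlip q (hsupp hq) q' (hsupp hq'), ?_⟩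
  filter_upwards [hmem] with ω h
  exact hgraph _ h

theorem integrable_inner_of_memLp {α E : Type*} [MeasurableSpace α] [NormedAddCommGroup E]
    [InnerProductSpace ℝ E] {μ : Measure α} {f g : α → E} (hf : MemLp f 2 μ) (hg : MemLp g 2 μ) :
    Integrable (fun a => inner ℝ (f a) (g a)) μ := by
  refine (L2.integrable_inner (𝕜 := ℝ) (hf.toLp f) (hg.toLp g)).congr ?_
  filter_upwards [hf.coeFn_toLp, hg.coeFn_toLp] with a h1 h2
  rw [h1, h2]

theorem memLp_of_coeFn_eq {x L : HilbertH d} {ξ : Eucl d → Eucl d} (hξ : Continuous ξ)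
    (h : L =ᵐ[cubeMeasure d] fun ω => ξ (x ω)) : MemLp ξ 2 (law x).toMeasure := by
  refine (memLp_map_measure_iff hξ.aestronglyMeasurable (measurable_coeFn_Lp x).aemeasurable).2 ?_
  exact (memLp_congr_ae h).1 (Lp.memLp L)

/-- The gradient field of a lift depends only on the law. -/
theorem field_ae_eq_of_law_eq (hU : Differentiable ℝ (hilbertLift U)) {x y : HilbertH d}
    (hxy : law x = law y) {ξ η : Eucl d → Eucl d} (hξ : Continuous ξ) (hη : Continuous η)
    (hx : liftGradient U x =ᵐ[cubeMeasure d] fun ω => ξ (x ω))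
    (hy : liftGradient U y =ᵐ[cubeMeasure d] fun ω => η (y ω)) :
    ξ =ᵐ[(law x).toMeasure] η := by
  have hmξ := memLp_of_coeFn_eq hξ hx
  have hmη := memLp_of_coeFn_eq hη hy
  have hζ := hmξ.sub (hxy ▸ hmη : MemLp η 2 (law x).toMeasure)
  have hζ' : MemLp (ξ - η) 2 (law y).toMeasure := hxy ▸ hζ
  have hcζ : Continuous (ξ - η) := hξ.sub hη
  -- Moving `z` along `(ξ - η) ∘ z` pushes its law forward by a map independent of `z`, so the
  -- perturbations of `x` and `y` keep equal laws and the lift has the same derivative along both.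
  have hlaw : ∀ (z : HilbertH d) (hz : MemLp (ξ - η) 2 (law z).toMeasure) (t : ℝ),
      (law (z + t • fieldComp z (ξ - η) hz)).toMeasure =
        (law z).toMeasure.map fun q => q + t • (ξ - η) q := by
    intro z hz t
    change (cubeMeasure d).map _ = ((cubeMeasure d).map z).map _
    rw [Measure.map_map (by fun_prop) (measurable_coeFn_Lp z)]
    refine Measure.map_congr ?_
    filter_upwards [Lp.coeFn_add z (t • fieldComp z (ξ - η) hz),
      Lp.coeFn_smul t (fieldComp z (ξ - η) hz), coeFn_fieldComp z (ξ - η) hz] with ω h1 h2 h3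
    rw [h1, Pi.add_apply, h2, Pi.smul_apply, h3, Function.comp_apply]
  have heq : ∀ t : ℝ, hilbertLift U (x + t • fieldComp x (ξ - η) hζ) =
      hilbertLift U (y + t • fieldComp y (ξ - η) hζ') := by
    intro t
    refine congrArg U (P2.ext ?_)
    rw [hlaw, hlaw, hxy]
  have hder : ∀ z w : HilbertH d, HasDerivAt (fun t : ℝ => hilbertLift U (z + t • w))
      (inner ℝ (liftGradient U z) w) 0 := by
    intro z w
    have h1 : HasDerivAt (fun t : ℝ => z + t • w) w 0 := by
      simpa using ((hasDerivAt_id (0 : ℝ)).smul_const w).const_add z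
    have h2 : HasFDerivAt (hilbertLift U) _ (z + (0 : ℝ) • w) :=
      (hasGradientAt_liftGradient hU _).hasFDerivAt
    have h3 := h2.comp_hasDerivAt (0 : ℝ) h1
    rw [zero_smul, add_zero] at h3
    exact h3
  have hinner : inner ℝ (liftGradient U x) (fieldComp x (ξ - η) hζ) =
      inner ℝ (liftGradient U y) (fieldComp y (ξ - η) hζ') := by
    have h1 := hder x (fieldComp x (ξ - η) hζ)
    simp only [heq] at h1
    exact h1.unique (hder y _)
  have hint : ∀ (z : HilbertH d) (hz : MemLp (ξ - η) 2 (law z).toMeasure) (σ : Eucl d → Eucl d),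
      Continuous σ → (liftGradient U z =ᵐ[cubeMeasure d] fun ω => σ (z ω)) →
      inner ℝ (liftGradient U z) (fieldComp z (ξ - η) hz) =
        ∫ q, inner ℝ (σ q) ((ξ - η) q) ∂(law z).toMeasure := by
    intro z hz σ hσ h
    change _ = ∫ q, inner ℝ (σ q) ((ξ - η) q) ∂((cubeMeasure d).map z)
    rw [integral_map (measurable_coeFn_Lp z).aemeasurable
      (by exact (hσ.inner hcζ).aestronglyMeasurable), L2.inner_def]
    refine integral_congr_ae ?_
    filter_upwards [h, coeFn_fieldComp z (ξ - η) hz] with ω h1 h2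
    rw [h1, h2]
  rw [hint x hζ ξ hξ hx, hint y hζ' η hη hy, ← hxy] at hinner
  have hmη' : MemLp η 2 (law x).toMeasure := hxy ▸ hmη
  have hi1 : Integrable (fun q => inner ℝ (ξ q) ((ξ - η) q)) (law x).toMeasure :=
    integrable_inner_of_memLp hmξ hζ
  have hi2 : Integrable (fun q => inner ℝ (η q) ((ξ - η) q)) (law x).toMeasure :=
    integrable_inner_of_memLp hmη' hζ
  have hzero : ∫ q, ‖(ξ - η) q‖ ^ 2 ∂(law x).toMeasure = 0 := by
    rw [← sub_eq_zero.2 hinner, ← integral_sub hi1 hi2]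
    refine integral_congr_ae (Eventually.of_forall fun q => ?_)
    simp only [← inner_sub_left, ← real_inner_self_eq_norm_sq, Pi.sub_apply]
  have := (integral_eq_zero_iff_of_nonneg (fun q => by positivity)
    hζ.integrable_norm_pow').1 hzero
  filter_upwards [this] with q hq
  simpa [sub_eq_zero] using hq

end GradientField

/-! ### Gradients that belong to the tangent space -/

section TangentFields

open Filter Topology

variable {d : ℕ}

/-- The class of `v` in `L²(μ)` is tangent at `μ`. -/
def IsTangentField (μ : P2 d) (v : Eucl d → Eucl d) : Prop :=
  ∃ h : MemLp v 2 μ.toMeasure, h.toLp v ∈ tangentSpace μ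

theorem tendsto_eLpNorm_two_sub_of_dominated {α E : Type*} [MeasurableSpace α]
    [NormedAddCommGroup E] {μ : Measure α} {v : ℕ → α → E} {w : α → E} {G : α → ℝ}
    (hv : ∀ n, AEStronglyMeasurable (v n) μ) (hw : AEStronglyMeasurable w μ) (hG : MemLp G 2 μ)
    (hvG : ∀ n, ∀ᵐ a ∂μ, ‖v n a‖ ≤ G a) (hwG : ∀ᵐ a ∂μ, ‖w a‖ ≤ G a)
    (hlim : ∀ᵐ a ∂μ, Tendsto (fun n => v n a) atTop (𝓝 (w a))) :
    Tendsto (fun n => eLpNorm (v n - w) 2 μ) atTop (𝓝 0) := by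
  have key : Tendsto (fun n => ∫⁻ a, ‖v n a - w a‖ₑ ^ 2 ∂μ) atTop (𝓝 (∫⁻ _, 0 ∂μ)) := by
    refine tendsto_lintegral_of_dominated_convergence' (fun a => ‖(2 : ℝ) * G a‖ₑ ^ 2)
      (fun n => (((hv n).sub hw).enorm).pow_const 2) (fun n => ?_) ?_ ?_
    · filter_upwards [hvG n, hwG] with a h1 h2
      gcongr
      refine enorm_le_iff_norm_le.2 ((norm_sub_le _ _).trans ((add_le_add h1 h2).trans ?_))
      rw [← two_mul]
      exact le_abs_self _
    · have h := (hG.const_mul 2).eLpNorm_lt_top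
      rw [eLpNorm_lt_top_iff_lintegral_rpow_enorm_lt_top (by norm_num) (by norm_num)] at h
      simpa using h.ne
    · filter_upwards [hlim] with a ha
      have h1 : Tendsto (fun n => ‖v n a - w a‖ₑ) atTop (𝓝 0) := by
        simpa using (ha.sub_const (w a)).enorm
      have h2 := ((ENNReal.continuous_pow 2).tendsto 0).comp h1
      rw [zero_pow two_ne_zero] at h2
      exact h2
  rw [lintegral_zero] at key
  have h2 := (ENNReal.continuous_rpow_const (y := (1 / 2 : ℝ))).tendsto 0 |>.comp key
  rw [ENNReal.zero_rpow_of_pos (by norm_num)] at h2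
  refine h2.congr fun n => ?_
  rw [eLpNorm_eq_lintegral_rpow_enorm_toReal (by norm_num) (by norm_num)]
  simp

/-- Dominated limits of tangent fields are tangent. -/
theorem IsTangentField.of_tendsto {μ : P2 d} {v : ℕ → Eucl d → Eucl d} {w : Eucl d → Eucl d}
    {G : Eucl d → ℝ} (hv : ∀ n, IsTangentField μ (v n)) (hG : MemLp G 2 μ.toMeasure)
    (hvG : ∀ n, ∀ᵐ q ∂μ.toMeasure, ‖v n q‖ ≤ G q)
    (hlim : ∀ᵐ q ∂μ.toMeasure, Tendsto (fun n => v n q) atTop (𝓝 (w q))) :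
    IsTangentField μ w := by
  choose hm ht using hv
  have hw : AEStronglyMeasurable w μ.toMeasure :=
    aestronglyMeasurable_of_tendsto_ae atTop (fun n => (hm n).1) hlim
  have hwG : ∀ᵐ q ∂μ.toMeasure, ‖w q‖ ≤ G q := by
    filter_upwards [hlim, ae_all_iff.2 hvG] with q h1 h2
    exact le_of_tendsto h1.norm (Eventually.of_forall h2)
  have hwm : MemLp w 2 μ.toMeasure := hG.of_le hw (by
    filter_upwards [hwG] with q h
    exact h.trans (le_abs_self _))
  refine ⟨hwm, isClosed_closure.mem_of_tendsto (b := atTop)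
    (f := fun n => (hm n).toLp (v n)) ?_ (Eventually.of_forall ht)⟩
  rw [Lp.tendsto_Lp_iff_tendsto_eLpNorm'']
  exact tendsto_eLpNorm_two_sub_of_dominated (fun n => (hm n).1) hw hG hvG hwG hlim

theorem norm_gradient_sub {E : Type*} [NormedAddCommGroup E] [InnerProductSpace ℝ E]
    [CompleteSpace E] (f g : E → ℝ) (q : E) :
    ‖gradient f q - gradient g q‖ = ‖fderiv ℝ f q - fderiv ℝ g q‖ := by
  rw [gradient, gradient, ← map_sub, LinearIsometryEquiv.norm_map]

theorem norm_gradient {E : Type*} [NormedAddCommGroup E] [InnerProductSpace ℝ E]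
    [CompleteSpace E] (f : E → ℝ) (q : E) : ‖gradient f q‖ = ‖fderiv ℝ f q‖ := by
  rw [gradient, LinearIsometryEquiv.norm_map]

/-- A compactly supported `C¹` function is a `C¹` limit of smooth compactly supported functions. -/
theorem exists_contDiff_norm_fderiv_sub_le {E : Type*} [NormedAddCommGroup E]
    [InnerProductSpace ℝ E] [FiniteDimensional ℝ E] [MeasurableSpace E] [BorelSpace E]
    {g : E → ℝ} (hg : ContDiff ℝ 1 g)
    (hc : HasCompactSupport g) {ε : ℝ} (hε : 0 < ε) :
    ∃ φ : E → ℝ, ContDiff ℝ (⊤ : ℕ∞) φ ∧ HasCompactSupport φ ∧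
      ∀ q, ‖fderiv ℝ φ q - fderiv ℝ g q‖ ≤ ε := by
  have hgc : Continuous (fderiv ℝ g) := hg.continuous_fderiv one_ne_zero
  have huc : UniformContinuous (fderiv ℝ g) :=
    hgc.uniformContinuous_of_tendsto_cocompact (x := 0) (hc.fderiv ℝ).is_zero_at_infty
  obtain ⟨δ, hδ, hδ'⟩ := Metric.uniformContinuous_iff.1 huc ε hε
  -- With a mollifier of radius `δ` and the derivative falling on `g`, the new derivative averages
  -- `fderiv ℝ g` over a `δ`-ball, where it varies by at most `ε`.
  let b : ContDiffBump (0 : E) := ⟨δ / 2, δ, by positivity, by linarith⟩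
  refine ⟨convolution (b.normed volume) g (ContinuousLinearMap.lsmul ℝ ℝ) volume, ?_, ?_, ?_⟩
  · exact b.hasCompactSupport_normed.contDiff_convolution_left _ b.contDiff_normed
      hg.continuous.locallyIntegrable
  · exact b.hasCompactSupport_normed.convolution _ hc
  · intro q
    have h1 := hc.hasFDerivAt_convolution_right (ContinuousLinearMap.lsmul ℝ ℝ)
      (b.continuous_normed (μ := volume)).locallyIntegrable hg q (μ := volume)
    have h2 : convolution (b.normed volume) (fderiv ℝ g)
        ((ContinuousLinearMap.lsmul ℝ ℝ).precompR E) volume q =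
        convolution (b.normed volume) (fderiv ℝ g) (ContinuousLinearMap.lsmul ℝ ℝ) volume q := by
      refine integral_congr_ae (Eventually.of_forall fun t => ?_)
      ext w
      simp
    rw [h1.fderiv, h2, ← dist_eq_norm]
    refine b.dist_normed_convolution_le hgc.aestronglyMeasurable fun p hp => ?_
    exact (hδ' hp).le

theorem memLp_affine_norm (μ : P2 d) (a b : ℝ) :
    MemLp (fun q : Eucl d => a + b * ‖q‖) 2 μ.toMeasure := by
  have hid : MemLp (fun q : Eucl d => q) 2 μ.toMeasure := by
    refine ⟨by fun_prop, ?_⟩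
    rw [eLpNorm_lt_top_iff_lintegral_rpow_enorm_lt_top (by norm_num) (by norm_num)]
    simpa using μ.secondMoment_lt_top
  exact (memLp_const a).add (hid.norm.const_mul b)

theorem isTangentField_gradient_of_hasCompactSupport (μ : P2 d) {g : Eucl d → ℝ}
    (hg : ContDiff ℝ 1 g) (hc : HasCompactSupport g) : IsTangentField μ (gradient g) := by
  have hsm : ∀ φ : Eucl d → ℝ, ContDiff ℝ (⊤ : ℕ∞) φ → HasCompactSupport φ →
      IsTangentField μ (gradient φ) := by
    intro φ hφ hφc
    have hcont : Continuous (gradient φ) :=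
      (InnerProductSpace.toDual ℝ (Eucl d)).symm.continuous.comp
        (hφ.continuous_fderiv (by simp))
    obtain ⟨B, hB⟩ := (hφc.fderiv ℝ).exists_bound_of_continuous
      (hφ.continuous_fderiv (by simp))
    have hm : MemLp (gradient φ) 2 μ.toMeasure :=
      MemLp.of_bound hcont.aestronglyMeasurable B (Eventually.of_forall fun q => by
        rw [norm_gradient]
        exact hB q)
    exact ⟨hm, subset_closure ⟨φ, hφ, hφc, hm.coeFn_toLp⟩⟩
  have hpos : ∀ n : ℕ, (0 : ℝ) < 1 / ((n : ℝ) + 1) := fun n => Nat.one_div_pos_of_nat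
  choose φ hφ hφc hφg using fun n : ℕ => exists_contDiff_norm_fderiv_sub_le hg hc (hpos n)
  obtain ⟨B, hB⟩ := (hc.fderiv ℝ).exists_bound_of_continuous (hg.continuous_fderiv one_ne_zero)
  refine IsTangentField.of_tendsto (G := fun _ => B + 1) (fun n => hsm (φ n) (hφ n) (hφc n))
    (memLp_const _) (fun n => Eventually.of_forall fun q => ?_) (Eventually.of_forall fun q => ?_)
  · rw [norm_gradient]
    have h1 : 1 / ((n : ℝ) + 1) ≤ 1 := by
      rw [div_le_one (by positivity)]
      linarith [n.cast_nonneg (α := ℝ)]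
    calc ‖fderiv ℝ (φ n) q‖ = ‖fderiv ℝ g q + (fderiv ℝ (φ n) q - fderiv ℝ g q)‖ := by
          congr 1; abel
      _ ≤ B + 1 := (norm_add_le _ _).trans (add_le_add (hB q) ((hφg n q).trans h1))
  · rw [tendsto_iff_norm_sub_tendsto_zero]
    refine squeeze_zero (fun _ => norm_nonneg _) (fun n => ?_)
      tendsto_one_div_add_atTop_nhds_zero_nat
    rw [norm_gradient_sub]
    exact hφg n q

/-- Growth of a function with Lipschitz gradient. -/
theorem abs_le_of_lipschitz_gradient {E : Type*} [NormedAddCommGroup E] [InnerProductSpace ℝ E]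
    {f : E → ℝ} (hf : Differentiable ℝ f) {a K : ℝ} (hK : 0 ≤ K)
    (hb : ∀ q, ‖fderiv ℝ f q‖ ≤ a + K * ‖q‖) (q : E) :
    |f q| ≤ |f 0| + (a + K * ‖q‖) * ‖q‖ := by
  have h := Convex.norm_image_sub_le_of_norm_fderiv_le (𝕜 := ℝ) (f := f)
    (s := Metric.closedBall (0 : E) ‖q‖) (C := a + K * ‖q‖) (x := 0) (y := q)
    (fun p _ => hf p) (fun p hp => (hb p).trans (by
      have : ‖p‖ ≤ ‖q‖ := by simpa using hp
      gcongr))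
    (convex_closedBall _ _) (by simp) (by simp)
  rw [sub_zero, Real.norm_eq_abs] at h
  have := abs_add_le (f 0) (f q - f 0)
  rw [add_sub_cancel] at this
  linarith

/-- The gradient of a function with Lipschitz gradient is tangent at every measure. -/
theorem isTangentField_gradient_of_lipschitz (μ : P2 d) {f : Eucl d → ℝ}
    (hf : Differentiable ℝ f) {K : ℝ} (hK : 0 ≤ K)
    (hlip : ∀ p q, ‖gradient f p - gradient f q‖ ≤ K * ‖p - q‖) :
    IsTangentField μ (gradient f) := by
  have hlip' : ∀ p q, ‖fderiv ℝ f p - fderiv ℝ f q‖ ≤ K * ‖p - q‖ := by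
    intro p q
    have := hlip p q
    rwa [gradient, gradient, ← map_sub, LinearIsometryEquiv.norm_map] at this
  have hcont : Continuous (fderiv ℝ f) :=
    (LipschitzWith.of_dist_le_mul (K := K.toNNReal) fun p q => by
      rw [dist_eq_norm, dist_eq_norm, Real.coe_toNNReal _ hK]
      exact hlip' p q).continuous
  have hf1 : ContDiff ℝ 1 f := contDiff_one_iff_fderiv.2 ⟨hf, hcont⟩
  set a := ‖fderiv ℝ f 0‖ with ha
  have hb : ∀ q, ‖fderiv ℝ f q‖ ≤ a + K * ‖q‖ := by
    intro q
    have h1 := hlip' q 0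
    rw [sub_zero] at h1
    have h2 := norm_add_le (fderiv ℝ f 0) (fderiv ℝ f q - fderiv ℝ f 0)
    rw [add_sub_cancel] at h2
    linarith
  let χ : ContDiffBump (0 : Eucl d) := ⟨1, 2, one_pos, one_lt_two⟩
  have hχ : ContDiff ℝ 1 χ := χ.contDiff
  obtain ⟨M, hM⟩ := (χ.hasCompactSupport.fderiv ℝ).exists_bound_of_continuous
    (hχ.continuous_fderiv one_ne_zero)
  have hM0 : 0 ≤ M := (norm_nonneg _).trans (hM 0)
  have hpos : ∀ n : ℕ, (0 : ℝ) < ((n : ℝ) + 1)⁻¹ := fun n => by positivity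
  -- Cutoffs at scale `n + 1`. The growth of `f` is at most quadratic, while the derivative of `χn
  -- n` is of order `1 / (n + 1)` and vanishes for `‖q‖ > 2 * (n + 1)`; their product is thus at
  -- most affine in `‖q‖`, uniformly in `n`, hence dominated in `L²(μ)`.
  let χn : ℕ → Eucl d → ℝ := fun n q => χ (((n : ℝ) + 1)⁻¹ • q)
  have hχn : ∀ n, ContDiff ℝ 1 (χn n) := fun n => hχ.comp (contDiff_const_smul _)
  have hχnd : ∀ n q, fderiv ℝ (χn n) q = ((n : ℝ) + 1)⁻¹ • fderiv ℝ χ (((n : ℝ) + 1)⁻¹ • q) :=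
    fun n q => fderiv_comp_smul _
  have hgc : ∀ n, HasCompactSupport (fun q => χn n q * f q) := fun n =>
    (χ.hasCompactSupport.comp_smul (hpos n).ne').mul_right
  have hgd : ∀ n, ContDiff ℝ 1 (fun q => χn n q * f q) := fun n => (hχn n).mul hf1
  refine IsTangentField.of_tendsto (v := fun n => gradient fun q => χn n q * f q)
    (G := fun q => (a * (1 + 2 * M) + |f 0| * M) + (K * (1 + 2 * M)) * ‖q‖)
    (fun n => isTangentField_gradient_of_hasCompactSupport μ (hgd n) (hgc n))
    (memLp_affine_norm μ _ _)
    (fun n => Eventually.of_forall fun q => ?_) (Eventually.of_forall fun q => ?_)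
  · have hfd : fderiv ℝ (fun q => χn n q * f q) q =
        χn n q • fderiv ℝ f q + f q • fderiv ℝ (χn n) q :=
      fderiv_fun_mul ((hχn n).differentiable one_ne_zero q) (hf q)
    rw [norm_gradient, hfd]
    have h1 : ‖χn n q • fderiv ℝ f q‖ ≤ a + K * ‖q‖ := by
      rw [norm_smul, Real.norm_of_nonneg χ.nonneg]
      exact (mul_le_of_le_one_left (norm_nonneg _) χ.le_one).trans (hb q)
    have h2 : ‖f q • fderiv ℝ (χn n) q‖ ≤ (|f 0| + 2 * (a + K * ‖q‖)) * M := by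
      rw [hχnd, norm_smul, norm_smul, Real.norm_eq_abs, Real.norm_of_nonneg (hpos n).le,
        ← mul_assoc]
      have ha0 : 0 ≤ a + K * ‖q‖ := (norm_nonneg _).trans (hb q)
      by_cases hq : ‖q‖ ≤ 2 * ((n : ℝ) + 1)
      · refine mul_le_mul ?_ (hM _) (norm_nonneg _) (by positivity)
        have h3 := abs_le_of_lipschitz_gradient hf hK hb q
        have h4 : |f q| ≤ (|f 0| + 2 * (a + K * ‖q‖)) * ((n : ℝ) + 1) := by
          refine h3.trans ?_
          have h5 : |f 0| * 1 ≤ |f 0| * ((n : ℝ) + 1) := by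
            gcongr
            linarith [n.cast_nonneg (α := ℝ)]
          have h6 := mul_le_mul_of_nonneg_left hq ha0
          linarith
        rw [← div_eq_mul_inv, div_le_iff₀ (by positivity)]
        exact h4
      · have h0 : fderiv ℝ χ (((n : ℝ) + 1)⁻¹ • q) = 0 := by
          refine image_eq_zero_of_notMem_tsupport fun h => hq ?_
          have := tsupport_fderiv_subset ℝ h
          rw [χ.tsupport_eq, mem_closedBall_zero_iff, norm_smul,
            Real.norm_of_nonneg (hpos n).le, inv_mul_le_iff₀ (by positivity)] at this
          change ‖q‖ ≤ ((n : ℝ) + 1) * 2 at this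
          linarith
        rw [h0, norm_zero, mul_zero]
        positivity
    have := (norm_add_le _ _).trans (add_le_add h1 h2)
    refine this.trans (le_of_eq ?_)
    ring
  · refine tendsto_const_nhds.congr' ?_
    obtain ⟨N, hN⟩ := exists_nat_gt ‖q‖
    filter_upwards [eventually_ge_atTop N] with n hn
    have hqn : ‖q‖ < (n : ℝ) + 1 := by
      have : (N : ℝ) ≤ n := by exact_mod_cast hn
      linarith
    have hev : (fun p => χn n p * f p) =ᶠ[𝓝 q] f := by
      have hopen : {p : Eucl d | ‖p‖ < (n : ℝ) + 1} ∈ 𝓝 q :=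
        (isOpen_lt continuous_norm continuous_const).mem_nhds hqn
      filter_upwards [hopen] with p hp
      have : χn n p = 1 := by
        refine χ.one_of_mem_closedBall ?_
        rw [mem_closedBall_zero_iff, norm_smul, Real.norm_of_nonneg (hpos n).le,
          inv_mul_le_iff₀ (by positivity)]
        change ‖p‖ ≤ ((n : ℝ) + 1) * 1
        rw [mul_one]
        exact le_of_lt hp
      rw [this, one_mul]
    rw [gradient, gradient, hev.fderiv_eq]

end TangentFields

/-! ### Tangency by collapsing small sets to a point -/

section Collapse

open Filter Topology

variable {d : ℕ} {U : P2 d → ℝ} {C : ℝ}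

/-- Second-order Taylor estimate for a lift with Lipschitz gradient. -/
theorem IsC11WithH.taylor (hU : IsC11WithH C (hilbertLift U)) (hC : 0 ≤ C) (x y : HilbertH d) :
    |hilbertLift U y - hilbertLift U x - inner ℝ (liftGradient U x) (y - x)| ≤
      C * ‖y - x‖ ^ 2 := by
  have h := Convex.norm_image_sub_le_of_norm_hasFDerivWithin_le' (𝕜 := ℝ) (f := hilbertLift U)
    (s := segment ℝ x y) (x := x) (y := y) (C := C * ‖y - x‖)
    (f' := fun z => InnerProductSpace.toDual ℝ (HilbertH d) (liftGradient U z))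
    (φ := InnerProductSpace.toDual ℝ (HilbertH d) (liftGradient U x))
    (fun z _ => (hasGradientAt_liftGradient hU.1 z).hasFDerivAt.hasFDerivWithinAt)
    (fun z hz => by
      rw [← map_sub, LinearIsometryEquiv.norm_map]
      refine (hU.norm_liftGradient_sub_le z x).trans ?_
      gcongr
      exact norm_sub_le_of_mem_segment hz)
    (convex_segment x y) (left_mem_segment ℝ x y) (right_mem_segment ℝ x y)
  rw [InnerProductSpace.toDual_apply_apply, Real.norm_eq_abs] at h
  refine h.trans (le_of_eq ?_)
  ring

/-- The element of `ℍ` equal to `q` on `A` and to `x` off `A`. -/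
def collapse (x : HilbertH d) {A : Set (Eucl d)} (hA : MeasurableSet A) (q : Eucl d) :
    HilbertH d :=
  ((Lp.memLp x).indicator hA.compl).toLp (Aᶜ.indicator x) +
    indicatorConstLp 2 hA (measure_ne_top (cubeMeasure d) A) q

theorem coeFn_collapse (x : HilbertH d) {A : Set (Eucl d)} (hA : MeasurableSet A) (q : Eucl d) :
    ∀ᵐ ω ∂cubeMeasure d, (ω ∈ A → collapse x hA q ω = q) ∧ (ω ∉ A → collapse x hA q ω = x ω) := by
  filter_upwards [Lp.coeFn_add (((Lp.memLp x).indicator hA.compl).toLp (Aᶜ.indicator x))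
    (indicatorConstLp 2 hA (measure_ne_top (cubeMeasure d) A) q),
    ((Lp.memLp x).indicator hA.compl).coeFn_toLp,
    indicatorConstLp_coeFn (p := 2) (hs := hA) (hμs := measure_ne_top (cubeMeasure d) A) (c := q)]
    with ω h1 h2 h3
  rw [collapse, h1, Pi.add_apply, h2, h3]
  constructor <;> intro h <;> simp [h]

theorem collapse_sub_collapse (x : HilbertH d) {A : Set (Eucl d)} (hA : MeasurableSet A)
    (q q' : Eucl d) : collapse x hA q - collapse x hA q' =
      indicatorConstLp 2 hA (measure_ne_top (cubeMeasure d) A) (q - q') := by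
  rw [collapse, collapse, add_sub_add_left_eq_sub, indicatorConstLp_sub]

theorem ofReal_norm_collapse_sub_sq (x : HilbertH d) {A : Set (Eucl d)} (hA : MeasurableSet A)
    (q : Eucl d) : ENNReal.ofReal (‖collapse x hA q - x‖ ^ 2) =
      ∫⁻ ω in A, ‖q - x ω‖ₑ ^ 2 ∂cubeMeasure d := by
  rw [ofReal_norm_sub_sq_Lp, ← lintegral_indicator hA]
  refine lintegral_congr_ae ?_
  filter_upwards [coeFn_collapse x hA q] with ω h
  by_cases hω : ω ∈ A
  · rw [Set.indicator_of_mem hω, h.1 hω]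
  · rw [Set.indicator_of_notMem hω, h.2 hω]
    simp

/-- The mean of the gradient of a lift over `A`, where the base point is collapsed to `q`. -/
def collapseGradient (U : P2 d → ℝ) (x : HilbertH d) {A : Set (Eucl d)} (hA : MeasurableSet A)
    (q : Eucl d) : Eucl d :=
  ((cubeMeasure d).real A)⁻¹ • ∫ ω in A, liftGradient U (collapse x hA q) ω ∂cubeMeasure d

/-- Collapsing a small set to a point gives a second-order Taylor estimate on `ℝ^d`. -/
theorem IsC11WithH.taylor_collapse (hU : IsC11WithH C (hilbertLift U)) (hC : 0 ≤ C)
    (x : HilbertH d) {A : Set (Eucl d)} (hA : MeasurableSet A) (hA0 : cubeMeasure d A ≠ 0)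
    (q q' : Eucl d) :
    |((cubeMeasure d).real A)⁻¹ * hilbertLift U (collapse x hA q') -
      ((cubeMeasure d).real A)⁻¹ * hilbertLift U (collapse x hA q) -
      inner ℝ (collapseGradient U x hA q) (q' - q)| ≤ C * ‖q' - q‖ ^ 2 := by
  have hm : 0 < (cubeMeasure d).real A := ENNReal.toReal_pos hA0 (measure_ne_top _ _)
  -- The inner product and the squared norm both scale with the mass of `A`, so dividing by it
  -- leaves a constant independent of `A`.
  have h := hU.taylor hC (collapse x hA q) (collapse x hA q')
  rw [collapse_sub_collapse, real_inner_comm, L2.inner_indicatorConstLp_eq_inner_setIntegral,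
    norm_indicatorConstLp (by norm_num) (by norm_num), mul_pow, ← Real.rpow_natCast
    (_ ^ _) 2, ← Real.rpow_mul hm.le] at h
  rw [collapseGradient, real_inner_comm, inner_smul_right, ← mul_sub, ← mul_sub, abs_mul,
    abs_of_pos (inv_pos.2 hm), inv_mul_le_iff₀ hm]
  refine h.trans (le_of_eq ?_)
  norm_num
  ring

theorem isTangentField_collapseGradient (hU : IsC11WithH C (hilbertLift U)) (hC : 0 ≤ C)
    (x : HilbertH d) {A : Set (Eucl d)} (hA : MeasurableSet A) (hA0 : cubeMeasure d A ≠ 0)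
    (μ : P2 d) : IsTangentField μ (collapseGradient U x hA) := by
  have ht := hU.taylor_collapse hC x hA hA0
  have hg : ∀ q, HasGradientAt (fun q => ((cubeMeasure d).real A)⁻¹ *
      hilbertLift U (collapse x hA q)) (collapseGradient U x hA q) q := fun q =>
    hasGradientAt_of_taylor ht q
  have heq : gradient (fun q => ((cubeMeasure d).real A)⁻¹ *
      hilbertLift U (collapse x hA q)) = collapseGradient U x hA := funext fun q => (hg q).gradient
  rw [← heq]
  refine isTangentField_gradient_of_lipschitz μ (fun q => (hg q).differentiableAt)
    (K := 6 * C) (by positivity) fun p q => ?_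
  rw [heq]
  exact norm_sub_le_of_taylor ht p q

/-- Collapsing a non-null set puts an atom at `q`, so the Lipschitz bound for the field of the
collapsed map is available at `q`. -/
theorem mem_support_law_collapse (x : HilbertH d) {A : Set (Eucl d)} (hA : MeasurableSet A)
    (hA0 : cubeMeasure d A ≠ 0) (q : Eucl d) :
    q ∈ (law (collapse x hA q)).toMeasure.support := by
  refine (Measure.mem_support_iff_forall q).2 fun V hV => ?_
  obtain ⟨W, hWV, hW, hqW⟩ := mem_nhds_iff.1 hV
  refine lt_of_lt_of_le (pos_iff_ne_zero.2 hA0) (le_trans ?_ (measure_mono hWV))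
  change _ ≤ ((cubeMeasure d).map (collapse x hA q)) W
  rw [Measure.map_apply (measurable_coeFn_Lp _) hW.measurableSet]
  refine measure_mono_ae ?_
  filter_upwards [coeFn_collapse x hA q] with ω h hω
  change collapse x hA q ω ∈ W
  rwa [h.1 hω]

/-- If the collapsed gradient at `q` is far from the gradient field, then the gradient of the lift
moves a lot near `q`. -/
theorem IsC11WithH.measure_le_of_le_norm_sub (hU : IsC11WithH C (hilbertLift U)) (hC : 0 ≤ C)
    (x : HilbertH d) {ξ : Eucl d → Eucl d} (hξ : LipschitzOnSupport C (law x) ξ)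
    (hx : liftGradient U x =ᵐ[cubeMeasure d] fun ω => ξ (x ω))
    {A : Set (Eucl d)} (hA : MeasurableSet A) (hA0 : cubeMeasure d A ≠ 0) {q : Eucl d}
    (hq : q ∈ (law x).toMeasure.support) {r s : ℝ} (hs : 0 ≤ s)
    (h : s + 2 * C * r ≤ ‖collapseGradient U x hA q - ξ q‖) :
    ENNReal.ofReal (s ^ 2) * (cubeMeasure d ({ω | ‖x ω - q‖ < r} \ A)) ≤
      ENNReal.ofReal (C ^ 2) * ENNReal.ofReal (‖collapse x hA q - x‖ ^ 2) := by
  obtain ⟨η, hη, hηlip, hηeq⟩ := hU.exists_field hC (collapse x hA q)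
  have hm : (cubeMeasure d).real A ≠ 0 :=
    (ENNReal.toReal_pos hA0 (measure_ne_top _ _)).ne'
  have hmean : collapseGradient U x hA q = η q := by
    rw [collapseGradient, inv_smul_eq_iff₀ hm, ← setIntegral_const]
    refine setIntegral_congr_ae hA ?_
    filter_upwards [hηeq, coeFn_collapse x hA q] with ω h1 h2 hω
    rw [h1, h2.1 hω]
  rw [hmean] at h
  have hlip := hU.norm_liftGradient_sub_le (collapse x hA q) x
  have hqc := mem_support_law_collapse x hA hA0 q
  have hsupp : ∀ z : HilbertH d, ∀ᵐ ω ∂cubeMeasure d, z ω ∈ (law z).toMeasure.support := fun z =>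
    ae_of_ae_map (measurable_coeFn_Lp z).aemeasurable Measure.support_mem_ae
  have hE : MeasurableSet ({ω | ‖x ω - q‖ < r} \ A) :=
    (measurableSet_lt ((measurable_coeFn_Lp x).sub_const q).norm measurable_const).diff hA
  calc ENNReal.ofReal (s ^ 2) * (cubeMeasure d ({ω | ‖x ω - q‖ < r} \ A))
      = ∫⁻ ω, ({ω | ‖x ω - q‖ < r} \ A).indicator (fun _ => ENNReal.ofReal (s ^ 2)) ω
          ∂cubeMeasure d := (lintegral_indicator_const hE _).symm
    _ ≤ ∫⁻ ω, ‖liftGradient U (collapse x hA q) ω - liftGradient U x ω‖ₑ ^ 2 ∂cubeMeasure d := by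
        refine lintegral_mono_ae ?_
        filter_upwards [hηeq, hx, coeFn_collapse x hA q, hsupp x, hsupp (collapse x hA q)]
          with ω h1 h2 h3 h4 h5
        refine Set.indicator_apply_le' (fun hω => ?_) (fun _ => zero_le)
        have hω1 : ‖x ω - q‖ < r := hω.1
        rw [h3.2 hω.2] at h1 h5
        rw [h1, h2, ← ofReal_norm, ← ENNReal.ofReal_pow (norm_nonneg _)]
        refine ENNReal.ofReal_le_ofReal (pow_le_pow_left₀ hs ?_ 2)
        have h6 := hηlip q hqc (x ω) h5
        have h7 := hξ (x ω) h4 q hq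
        rw [norm_sub_rev q] at h6
        have h8 : C * ‖x ω - q‖ ≤ C * r := by gcongr
        -- Off `A` the collapsed map equals `x`. Both fields vary by at most `C * r` between `q` and
        -- `x ω`, so the gap at `q` leaves a gap of at least `s` at `x ω`.
        have h9 : ‖η q - ξ q‖ ≤ ‖η q - η (x ω)‖ + ‖η (x ω) - ξ (x ω)‖ + ‖ξ (x ω) - ξ q‖ := by
          calc ‖η q - ξ q‖ = ‖(η q - η (x ω)) + (η (x ω) - ξ (x ω)) + (ξ (x ω) - ξ q)‖ := by
                congr 1; abel
            _ ≤ _ := norm_add₃_le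
        linarith
    _ = ENNReal.ofReal (‖liftGradient U (collapse x hA q) - liftGradient U x‖ ^ 2) :=
        (ofReal_norm_sub_sq_Lp _ _).symm
    _ ≤ ENNReal.ofReal (C ^ 2) * ENNReal.ofReal (‖collapse x hA q - x‖ ^ 2) := by
        rw [← ENNReal.ofReal_mul (sq_nonneg C), ← mul_pow]
        exact ENNReal.ofReal_le_ofReal (pow_le_pow_left₀ (norm_nonneg _) hlip 2)

/-- The cube of positive dimension has sets of arbitrarily small positive measure. -/
theorem exists_small_sets [NeZero d] : ∃ A : ℕ → Set (Eucl d), (∀ n, MeasurableSet (A n)) ∧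
    (∀ n, cubeMeasure d (A n) ≠ 0) ∧ Tendsto (fun n => cubeMeasure d (A n)) atTop (𝓝 0) := by
  have hmp := measurePreserving_coord (0 : Fin d)
  have hval : ∀ n : ℕ, cubeMeasure d
      ((fun ω : Eucl d => ω 0) ⁻¹' Set.Ioo (0 : ℝ) (1 / ((n : ℝ) + 1))) =
      ENNReal.ofReal (1 / ((n : ℝ) + 1)) := by
    intro n
    have h1 : 1 / ((n : ℝ) + 1) ≤ 1 := by
      rw [div_le_one (by positivity)]
      linarith [n.cast_nonneg (α := ℝ)]
    rw [hmp.measure_preimage measurableSet_Ioo.nullMeasurableSet,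
      Measure.restrict_apply measurableSet_Ioo,
      Set.inter_eq_left.2 (Set.Ioo_subset_Ioo_right h1), Real.volume_Ioo, sub_zero]
  refine ⟨fun n => (fun ω : Eucl d => ω 0) ⁻¹' Set.Ioo (0 : ℝ) (1 / ((n : ℝ) + 1)),
    fun n => hmp.measurable measurableSet_Ioo, fun n => ?_, ?_⟩
  · rw [hval]
    exact (ENNReal.ofReal_pos.2 Nat.one_div_pos_of_nat).ne'
  · simp only [hval]
    have := ENNReal.tendsto_ofReal (tendsto_one_div_add_atTop_nhds_zero_nat (𝕜 := ℝ))
    rwa [ENNReal.ofReal_zero] at this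

/-- The collapsed gradients converge to the gradient field on the support. -/
theorem IsC11WithH.tendsto_collapseGradient (hU : IsC11WithH C (hilbertLift U)) (hC : 0 ≤ C)
    (x : HilbertH d) {ξ : Eucl d → Eucl d} (hξ : LipschitzOnSupport C (law x) ξ)
    (hx : liftGradient U x =ᵐ[cubeMeasure d] fun ω => ξ (x ω))
    {A : ℕ → Set (Eucl d)} (hA : ∀ n, MeasurableSet (A n)) (hA0 : ∀ n, cubeMeasure d (A n) ≠ 0)
    (hlim : Tendsto (fun n => cubeMeasure d (A n)) atTop (𝓝 0)) {q : Eucl d}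
    (hq : q ∈ (law x).toMeasure.support) :
    Tendsto (fun n => collapseGradient U x (hA n) q) atTop (𝓝 (ξ q)) := by
  rw [Metric.tendsto_atTop']
  suffices h : ∀ ε > 0, ∀ᶠ n in atTop, dist (collapseGradient U x (hA n) q) (ξ q) < ε by
    intro ε hε
    obtain ⟨N, hN⟩ := eventually_atTop.1 (h ε hε)
    exact ⟨N, fun n hn => hN n hn.le⟩
  intro ε hε
  -- Chosen so that `2 * C * r ≤ ε / 2`. If the gap stayed at least `ε`, a positive lower bound from
  -- the ball around `q` would be at most an integral over `A n`, which tends to zero.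
  set r : ℝ := ε / (4 * (C + 1)) with hr
  have hrpos : 0 < r := by positivity
  have hCr : 2 * C * r ≤ ε / 2 := by
    have : r * (4 * (C + 1)) = ε := by rw [hr]; field_simp
    nlinarith
  have hB : MeasurableSet {ω | ‖x ω - q‖ < r} :=
    measurableSet_lt ((measurable_coeFn_Lp x).sub_const q).norm measurable_const
  have hBpos : cubeMeasure d {ω | ‖x ω - q‖ < r} ≠ 0 := by
    have h := (Measure.mem_support_iff_forall q).1 hq _ (Metric.ball_mem_nhds q hrpos)
    change 0 < ((cubeMeasure d).map x) (Metric.ball q r) at h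
    rw [Measure.map_apply (measurable_coeFn_Lp x) Metric.isOpen_ball.measurableSet] at h
    convert h.ne' using 3
    ext ω
    simp [dist_eq_norm]
  have hL : Tendsto (fun n => ENNReal.ofReal ((ε / 2) ^ 2) *
      (cubeMeasure d {ω | ‖x ω - q‖ < r} - cubeMeasure d (A n))) atTop
      (𝓝 (ENNReal.ofReal ((ε / 2) ^ 2) * (cubeMeasure d {ω | ‖x ω - q‖ < r} - 0))) :=
    ENNReal.Tendsto.const_mul (ENNReal.Tendsto.sub tendsto_const_nhds hlim
      (Or.inl (measure_ne_top _ _))) (Or.inr ENNReal.ofReal_ne_top)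
  have hfin : ∫⁻ ω, ‖q - x ω‖ₑ ^ 2 ∂cubeMeasure d ≠ ∞ := by
    have h := ofReal_norm_collapse_sub_sq x MeasurableSet.univ q
    rw [setLIntegral_univ] at h
    rw [← h]
    exact ENNReal.ofReal_ne_top
  have hR : Tendsto (fun n => ENNReal.ofReal (C ^ 2) *
      ENNReal.ofReal (‖collapse x (hA n) q - x‖ ^ 2)) atTop (𝓝 (ENNReal.ofReal (C ^ 2) * 0)) := by
    refine ENNReal.Tendsto.const_mul ?_ (Or.inr ENNReal.ofReal_ne_top)
    simp only [ofReal_norm_collapse_sub_sq]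
    exact tendsto_setLIntegral_zero hfin hlim
  have hpos : ENNReal.ofReal (C ^ 2) * 0 <
      ENNReal.ofReal ((ε / 2) ^ 2) * (cubeMeasure d {ω | ‖x ω - q‖ < r} - 0) := by
    rw [mul_zero, tsub_zero]
    exact ENNReal.mul_pos (ENNReal.ofReal_pos.2 (by positivity)).ne' hBpos
  filter_upwards [hR.eventually_lt hL hpos] with n hn
  by_contra! hcon
  rw [dist_eq_norm] at hcon
  have := hU.measure_le_of_le_norm_sub hC x hξ hx (hA n) (hA0 n) hq (r := r) (s := ε / 2)
    (by positivity) (by linarith)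
  refine absurd (this.trans_lt hn) (not_lt.2 ?_)
  gcongr
  exact le_measure_sdiff

/-- The gradient field of a lift is tangent. -/
theorem IsC11WithH.isTangentField [NeZero d] (hU : IsC11WithH C (hilbertLift U)) (hC : 0 ≤ C)
    (x : HilbertH d) {ξ : Eucl d → Eucl d} (hξ : LipschitzOnSupport C (law x) ξ)
    (hx : liftGradient U x =ᵐ[cubeMeasure d] fun ω => ξ (x ω)) :
    IsTangentField (law x) ξ := by
  obtain ⟨A, hA, hA0, hlim⟩ := exists_small_sets (d := d)
  have hconv : ∀ q ∈ (law x).toMeasure.support,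
      Tendsto (fun n => collapseGradient U x (hA n) q) atTop (𝓝 (ξ q)) := fun q hq =>
    hU.tendsto_collapseGradient hC x hξ hx hA hA0 hlim hq
  obtain ⟨q₀, hq₀⟩ := Measure.nonempty_support (IsProbabilityMeasure.ne_zero (law x).toMeasure)
  -- A bound at one point together with the common Lipschitz constant `6 * C` yields an affine
  -- dominating function.
  obtain ⟨B, hB⟩ := (hconv q₀ hq₀).norm.bddAbove_range
  refine IsTangentField.of_tendsto (v := fun n => collapseGradient U x (hA n))
    (G := fun q => (B + 6 * C * ‖q₀‖) + (6 * C) * ‖q‖)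
    (fun n => isTangentField_collapseGradient hU hC x (hA n) (hA0 n) (law x))
    (memLp_affine_norm _ _ _) (fun n => Eventually.of_forall fun q => ?_) ?_
  · have h1 := norm_sub_le_of_taylor (hU.taylor_collapse hC x (hA n) (hA0 n)) q q₀
    have h2 : ‖collapseGradient U x (hA n) q₀‖ ≤ B := hB ⟨n, rfl⟩
    have h3 := norm_add_le (collapseGradient U x (hA n) q - collapseGradient U x (hA n) q₀)
      (collapseGradient U x (hA n) q₀)
    rw [sub_add_cancel] at h3
    have h4 : 6 * C * ‖q - q₀‖ ≤ 6 * C * (‖q‖ + ‖q₀‖) := by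
      gcongr
      exact norm_sub_le _ _
    linarith
  · filter_upwards [Measure.support_mem_ae (μ := (law x).toMeasure)] with q hq
    exact hconv q hq

end Collapse

/-! ### From regularity of the lift to Wasserstein space -/

section FromHilbert

variable {d : ℕ} {U : P2 d → ℝ} {C : ℝ}

/-- A lift with Lipschitz gradient has, at every law, a Lipschitz tangent gradient field. -/
theorem IsC11WithH.exists_gradientField [NeZero d] (hU : IsC11WithH C (hilbertLift U)) (hC : 0 ≤ C)
    (μ : P2 d) : ∃ ξ : Eucl d → Eucl d, IsTangentField μ ξ ∧ LipschitzOnSupport C μ ξ ∧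
      ∀ x : HilbertH d, law x = μ → liftGradient U x =ᵐ[cubeMeasure d] fun ω => ξ (x ω) := by
  obtain ⟨x, rfl⟩ := exists_law_eq μ
  obtain ⟨ξ, hξ, hlip, hx⟩ := hU.exists_field hC x
  refine ⟨ξ, hU.isTangentField hC x hlip hx, hlip, fun y hy => ?_⟩
  obtain ⟨η, hη, -, hyη⟩ := hU.exists_field hC y
  have h := field_ae_eq_of_law_eq hU.1 hy hη hξ hyη hx
  filter_upwards [hyη, ae_of_ae_map (measurable_coeFn_Lp y).aemeasurable h] with ω h1 h2
  rw [h1, h2]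

theorem IsC11WithH.abs_sub_sub_le [NeZero d] (hU : IsC11WithH C (hilbertLift U)) (hC : 0 ≤ C)
    {μ : P2 d} {ξ : Eucl d → Eucl d} (hm : MemLp ξ 2 μ.toMeasure)
    (hξ : ∀ x : HilbertH d, law x = μ → liftGradient U x =ᵐ[cubeMeasure d] fun ω => ξ (x ω))
    {ν : P2 d} {γ : Measure (Eucl d × Eucl d)} (hγ : γ ∈ optimalPlans μ ν) :
    |U ν - U μ - ∫ p, inner ℝ (ξ p.1) (p.2 - p.1) ∂γ| ≤ C * W2 μ ν ^ 2 := by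
  obtain ⟨x, y, rfl, rfl, rfl, hW⟩ := exists_pairLaw_eq_of_optimal hγ
  rw [integral_pairLaw hm (hξ x rfl), ← hW]
  exact hU.taylor hC x y

/-- A quadratic error is `o(W₂)`, uniformly over optimal plans. -/
theorem hasWassersteinGradientAt_of_abs_sub_sub_le {μ : P2 d} {ξ : Eucl d → Eucl d}
    (hC : 0 ≤ C) (hξ : IsTangentField μ ξ)
    (h : ∀ ν : P2 d, ∀ γ ∈ optimalPlans μ ν,
      |U ν - U μ - ∫ p, inner ℝ (ξ p.1) (p.2 - p.1) ∂γ| ≤ C * W2 μ ν ^ 2) :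
    HasWassersteinGradientAt U μ ξ := by
  refine ⟨hξ, fun ε hε => ⟨ε / (C + 1), by positivity, fun ν hν γ hγ => (h ν γ hγ).trans ?_⟩⟩
  rw [lt_div_iff₀ (by positivity)] at hν
  nlinarith [W2_nonneg μ ν]

theorem IsC11WithH.isC11Wasserstein [NeZero d] (hU : IsC11WithH C (hilbertLift U)) (hC : 0 ≤ C) :
    IsC11Wasserstein U := by
  choose G hGt hGlip hG using hU.exists_gradientField hC
  have htaylor : ∀ μ ν : P2 d, ∀ γ ∈ optimalPlans μ ν,
      |U ν - U μ - ∫ p, inner ℝ (G μ p.1) (p.2 - p.1) ∂γ| ≤ C * W2 μ ν ^ 2 := fun μ ν γ hγ =>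
    hU.abs_sub_sub_le hC (hGt μ).1 (hG μ) hγ
  refine ⟨G, ⟨fun μ => hasWassersteinGradientAt_of_abs_sub_sub_le hC (hGt μ) (htaylor μ),
    fun μ ε hε => ⟨Real.sqrt ε / (C + 1), by positivity, fun ν hν γ hγ => ?_⟩⟩,
    C, hC, hGlip, htaylor⟩
  obtain ⟨x, y, rfl, rfl, rfl, hW⟩ := exists_pairLaw_eq_of_optimal hγ
  rw [lintegral_pairLaw_sub (hGt _).1 (hGt _).1 (hG _ x rfl) (hG _ y rfl)]
  refine ENNReal.ofReal_le_ofReal ?_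
  rw [lt_div_iff₀ (by positivity), ← hW] at hν
  have h1 := hU.norm_liftGradient_sub_le y x
  have h2 : ‖liftGradient U y - liftGradient U x‖ ≤ Real.sqrt ε := by
    nlinarith [norm_nonneg (y - x)]
  calc ‖liftGradient U y - liftGradient U x‖ ^ 2 ≤ Real.sqrt ε ^ 2 := by gcongr
    _ = ε := Real.sq_sqrt hε.le

/-- For `d > 0` the space `ℍ` contains a nonzero element, here a constant map, and the Lipschitz
bound between it and `0` forces the sign. -/
theorem IsC11WithH.nonneg [NeZero d] (hU : IsC11WithH C (hilbertLift U)) : 0 ≤ C := by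
  let e : HilbertH d := indicatorConstLp 2 MeasurableSet.univ
    (measure_ne_top (cubeMeasure d) Set.univ) (EuclideanSpace.single 0 1)
  have he : 0 < ‖e‖ := by
    rw [norm_indicatorConstLp (by norm_num) (by norm_num)]
    simp
  have h := (norm_nonneg _).trans (hU.2 e 0)
  rw [sub_zero] at h
  exact nonneg_of_mul_nonneg_left h he

end FromHilbert

/-! ### The degenerate dimension -/

section DimensionZero

/-- In dimension zero every field is tangent and every function is differentiable. -/
theorem hasWassersteinGradientAt_of_dim_zero (U : P2 0 → ℝ) (μ : P2 0) (ξ : Eucl 0 → Eucl 0) :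
    HasWassersteinGradientAt U μ ξ := by
  have hξ : ξ = gradient (fun _ : Eucl 0 => (0 : ℝ)) := Subsingleton.elim _ _
  refine hasWassersteinGradientAt_of_abs_sub_sub_le (C := 0) le_rfl ?_ fun ν γ hγ => ?_
  · rw [hξ]
    exact isTangentField_gradient_of_lipschitz μ (differentiable_const 0) le_rfl
      fun p q => by simp [Subsingleton.elim p q]
  · have hν : ν = μ := by
      ext1
      rw [← hγ.1.2, ← hγ.1.1, Subsingleton.elim (Prod.snd : Eucl 0 × Eucl 0 → Eucl 0) Prod.fst]
    have hinner : ∀ p : Eucl 0 × Eucl 0, inner ℝ (ξ p.1) (p.2 - p.1) = 0 := fun p => by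
      rw [Subsingleton.elim (ξ p.1) 0, inner_zero_left]
    simp [hν, hinner]

theorem lipschitzOnSupport_of_dim_zero (C : ℝ) (μ : P2 0) (ξ : Eucl 0 → Eucl 0) :
    LipschitzOnSupport C μ ξ := fun q _ q' _ => by simp [Subsingleton.elim q q']

theorem isC11Wasserstein_of_dim_zero (U : P2 0 → ℝ) : IsC11Wasserstein U := by
  refine ⟨fun _ _ => 0, ⟨fun μ => hasWassersteinGradientAt_of_dim_zero U μ _,
    fun μ ε hε => ⟨1, one_pos, fun ν _ γ _ => by simp⟩⟩, 0, le_rfl,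
    fun μ => lipschitzOnSupport_of_dim_zero 0 μ _, fun μ ν γ hγ => ?_⟩
  have hν : ν = μ := by
    ext1
    rw [← hγ.1.2, ← hγ.1.1, Subsingleton.elim (Prod.snd : Eucl 0 × Eucl 0 → Eucl 0) Prod.fst]
  simp [hν]

end DimensionZero

end

theorem mainTheorem8 (d : ℕ) (U : P2 d → ℝ) :
    (IsC11Wasserstein U ↔ IsC11H (hilbertLift U)) ∧
    (∀ C : ℝ, IsC11WithH C (hilbertLift U) →
      ∀ μ : P2 d, ∃ ξ : Eucl d → Eucl d, HasWassersteinGradientAt U μ ξ ∧ LipschitzOnSupport C μ ξ) := by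
  -- Realization draws its randomness from a coordinate of the cube, so `d = 0` is separate; there
  -- the Lipschitz bound is trivial even for negative `C`.
  rcases Nat.eq_zero_or_pos d with rfl | hd
  · exact ⟨⟨IsC11Wasserstein.isC11H, fun _ => isC11Wasserstein_of_dim_zero U⟩, fun C _ μ =>
      ⟨0, hasWassersteinGradientAt_of_dim_zero U μ 0, lipschitzOnSupport_of_dim_zero C μ 0⟩⟩
  · have : NeZero d := ⟨hd.ne'⟩
    refine ⟨⟨IsC11Wasserstein.isC11H, fun ⟨C, hC, h⟩ => h.isC11Wasserstein hC.le⟩,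
      fun C hU μ => ?_⟩
    obtain ⟨ξ, hξ, hlip, hgrad⟩ := hU.exists_gradientField hU.nonneg μ
    exact ⟨ξ, hasWassersteinGradientAt_of_abs_sub_sub_le hU.nonneg hξ
      fun ν γ hγ => hU.abs_sub_sub_le hU.nonneg hξ.1 hgrad hγ, hlip⟩
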